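/- Let $\mathcal A$ be a commutative $\mathbb C$-algebra, $\mathcal C=\mathcal A[[t]]$ with $t=(t_1,t_2,\dots)$, and let $\mathcal R$ be $\mathcal C[[x]]$ or $\mathcal C((x))$, $\partial=\partial/\partial x$. Let $\mathcal E$ be the algebra of microdifferential operators $P=\sum_{k\in\mathbb Z}a_k\partial^k$ ($a_k\in\mathcal R$, $a_k=0$ for $k\gg0$) with the product $$\Bigl(\sum_l a_l\partial^l\Bigr)\Bigl(\sum_m b_m\partial^m\Bigr)=\sum_k\Bigl(\sum_{l+m-r=k,\ r\ge0}\tbinom{l}{r}a_l\,b_m^{(r)}\Bigr)\partial^k ,$$ and put $P_+=\sum_{k\ge0}a_k\partial^k$. Derivatives of operators with respect to time variables are taken coefficientwise. Let $B_n=\partial^n+b_{n,n-1}\partial^{n-1}+\dots+b_{n,0}$ ($n=1,2,\dots$, $b_{n,k}\in\mathcal R$) satisfy the Zakharov–Shabat equations $$\frac{\partial B_n}{\partial t_m}-\frac{\partial B_m}{\partial t_n}+[B_n,B_m]=0\qquad(n,m\ge1).$$ Then there exist a monic first-order operator $L=\partial+u_0+u_{-1}\partial^{-1}+\dots\in\mathcal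 E$, series $\tilde t_n\in\mathcal A[[t]]$ ($n\geq1$) such that $\tilde t_n-t_n$ is a power series in $t_{n+1},t_{n+2},\dots$ without constant term, and $f_0\in\mathcal R$ with $f_0|_{t=0}=0$, such that: 1. the substitution $h(x,t)\mapsto h(x,\tilde t(t))$ is a bijection of $\mathcal R$ onto itself (so $t\mapsto\tilde t$ is a change of coordinates), and in the new time variables $$\frac{\partial L}{\partial\tilde t_n}=[(L^n)_+,L]\qquad(n\ge1);$$ 2. for all $n\ge1$, $$B_n=\tilde B_n+\sum_{k=1}^{n-1}\frac{\partial\tilde t_k}{\partial t_n}\tilde B_k+\frac{\partial f_0}{\partial t_n},\qquad \tilde B_k:=e^{f_0}(L^k)_+e^{-f_0};$$ 3. if $b_{n,n-1}=0$ for all $n\ge1$, then $u_0=0$ (so that $L$ is a Lax operator of the KP hierarchy with respect to the variables $\tilde t$), $\partial f_0=0$, and $\tilde B_n=(L^n)_+$ for all $n$. Here $e^{\pm f_0}=\sum_k(\pm f_0)^k/k!$ is formed in $\mathcal A((x))[[t]]\supset\mathcal R$. -/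

import Mathlib

open scoped Differential

noncomputable section

namespace KP

/-! ### Microdifferential operators over a commutative differential ring -/

section Microdifferential

variable {R : Type*}

/-- The sequences `(a_k)_{k ∈ ℤ}` in `R` with `a_k = 0` for `k ≫ 0`. -/
def boundedAbove (R : Type*) [AddCommGroup R] : AddSubgroup (ℤ → R) where
  carrier := {a | ∃ N : ℤ, ∀ k, N < k → a k = 0}
  zero_mem' := ⟨0, fun _ _ => rfl⟩
  add_mem' := by
    rintro a b ⟨N, hN⟩ ⟨M, hM⟩
    refine ⟨max N M, fun k hk => ?_⟩
    simp [hN k (lt_of_le_of_lt (le_max_left _ _) hk), hM k (lt_of_le_of_lt (le_max_right _ _) hk)]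
  neg_mem' := by
    rintro a ⟨N, hN⟩
    exact ⟨N, fun k hk => by simp [hN k hk]⟩

/-- Microdifferential operators `P = ∑_{k ∈ ℤ} a_k ∂^k`, with `a_k ∈ R` and `a_k = 0` for
`k ≫ 0`, written with the coefficients to the left of the powers of `∂`. -/
def MicroDiff (R : Type*) [AddCommGroup R] : Type _ := boundedAbove R

instance [AddCommGroup R] : AddCommGroup (MicroDiff R) :=
  inferInstanceAs (AddCommGroup (boundedAbove R))

namespace MicroDiff

/-- The coefficient `a_k` of `∂^k` in `P = ∑ a_k ∂^k`. -/
def coeff [AddCommGroup R] (P : MicroDiff R) (k : ℤ) : R := P.1 k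

/-- Apply an additive map to every coefficient. -/
def map [AddCommGroup R] (φ : R →+ R) (P : MicroDiff R) : MicroDiff R :=
  ⟨fun k => φ (P.coeff k), by
    obtain ⟨N, hN⟩ := P.2
    exact ⟨N, fun k hk => by simp [coeff, hN k hk]⟩⟩

/-- The differential operator part `P_+ = ∑_{k ≥ 0} a_k ∂^k`. -/
def plus [AddCommGroup R] (P : MicroDiff R) : MicroDiff R :=
  ⟨fun k => if 0 ≤ k then P.coeff k else 0, by
    obtain ⟨N, hN⟩ := P.2
    exact ⟨N, fun k hk => by simp [coeff, hN k hk]⟩⟩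

/-- The multiplication operator `c = c ∂^0`. -/
def ofFun [AddCommGroup R] (c : R) : MicroDiff R :=
  ⟨fun k => if k = 0 then c else 0, ⟨0, fun _ hk => if_neg hk.ne'⟩⟩

instance [CommRing R] : One (MicroDiff R) := ⟨ofFun 1⟩

/-- The product given by the extended Leibniz rule: the coefficient of `∂^k` in
`(∑ a_l ∂^l) (∑ b_m ∂^m)` is the sum of `binom(l, r) a_l b_m^{(r)}` over all `l, m ∈ ℤ` and
`r ≥ 0` with `l + m - r = k`. Only finitely many terms are non-zero. -/
instance [CommRing R] [Differential R] : Mul (MicroDiff R) where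
  mul P Q := ⟨fun k => ∑ᶠ p : ℤ × ℕ,
      Ring.choose p.1 p.2 • (P.coeff p.1 * (fun b : R => b′)^[p.2] (Q.coeff (k - p.1 + p.2))), by
    obtain ⟨N, hN⟩ := P.2
    obtain ⟨M, hM⟩ := Q.2
    have h0 : ∀ r : ℕ, (fun b : R => b′)^[r] 0 = 0 := fun r => by
      induction r with
      | zero => rfl
      | succ r ih => rw [Function.iterate_succ_apply', ih, map_zero]
    refine ⟨N + M, fun k hk => finsum_eq_zero_of_forall_eq_zero fun p => ?_⟩
    by_cases hp : N < p.1
    · simp [coeff, hN p.1 hp]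
    · simp [coeff, hM (k - p.1 + p.2) (by omega), h0]⟩

instance [CommRing R] [Differential R] : Pow (MicroDiff R) ℕ := ⟨fun P n => npowRec n P⟩

/-- The commutator `[P, Q] = P Q - Q P`. -/
def comm [CommRing R] [Differential R] (P Q : MicroDiff R) : MicroDiff R := P * Q - Q * P

/-- `P = ∂^n + (terms of order < n)`. -/
def IsMonic [CommRing R] (P : MicroDiff R) (n : ℤ) : Prop :=
  P.coeff n = 1 ∧ ∀ k, n < k → P.coeff k = 0

/-- `P` has no negative powers of `∂`. -/
def IsDifferential [CommRing R] (P : MicroDiff R) : Prop := ∀ k < 0, P.coeff k = 0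

end MicroDiff

end Microdifferential

/-! ### Formal functions of `x` and of the times `t_1, t_2, …` -/

section Functions

variable {A : Type*} [CommRing A]

theorem laurent_coeff_mul (f g : LaurentSeries A) (a b n : ℤ) (hf : ∀ i < a, f.coeff i = 0)
    (hg : ∀ i < b, g.coeff i = 0) :
    (f * g).coeff n = ∑ i ∈ Finset.Icc a (n - b), f.coeff i * g.coeff (n - i) := by
  rw [HahnSeries.coeff_mul]
  refine Finset.sum_of_injOn Prod.fst ?_ ?_ ?_ ?_
  · rintro ⟨i, j⟩ h ⟨i', j'⟩ h' e
    simp only [Finset.mem_coe, Finset.mem_antidiagonal] at h h'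
    simp only [Prod.mk.injEq] at e ⊢
    omega
  · rintro ⟨i, j⟩ h
    simp only [Finset.mem_coe, Finset.mem_antidiagonal, HahnSeries.mem_support] at h
    have h1 : a ≤ i := not_lt.1 fun hi => h.1 (hf i hi)
    have h2 : b ≤ j := not_lt.1 fun hi => h.2.1 (hg j hi)
    simp only [Finset.coe_Icc, Set.mem_Icc]
    omega
  · intro i _ hi
    by_contra hne
    refine hi ⟨(i, n - i), ?_, rfl⟩
    simp only [Finset.mem_coe, Finset.mem_antidiagonal, HahnSeries.mem_support]
    exact ⟨left_ne_zero_of_mul hne, right_ne_zero_of_mul hne, by omega⟩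
  · rintro ⟨i, j⟩ h
    simp only [Finset.mem_antidiagonal] at h
    rw [show n - i = j by omega]

theorem laurent_derivative_mul (f g : LaurentSeries A) :
    LaurentSeries.derivative ℤ (f * g) =
      f * LaurentSeries.derivative ℤ g + g * LaurentSeries.derivative ℤ f := by
  have hf : ∀ i < f.order, f.coeff i = 0 := fun i hi => HahnSeries.coeff_eq_zero_of_lt_order hi
  have hg : ∀ i < g.order, g.coeff i = 0 := fun i hi => HahnSeries.coeff_eq_zero_of_lt_order hi
  have hd : ∀ (h : LaurentSeries A) (n : ℤ),
      (LaurentSeries.derivative ℤ h).coeff n = (n + 1) • h.coeff (n + 1) := fun h n => by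
    rw [LaurentSeries.derivative_apply, LaurentSeries.hasseDeriv_coeff]
    simp
  have hdz : ∀ (h : LaurentSeries A), ∀ i < h.order - 1,
      (LaurentSeries.derivative ℤ h).coeff i = 0 := fun h i hi => by
    rw [hd, HahnSeries.coeff_eq_zero_of_lt_order (by omega), smul_zero]
  ext n
  rw [hd, HahnSeries.coeff_add, mul_comm g,
    laurent_coeff_mul f g _ _ _ hf hg, laurent_coeff_mul f _ _ _ _ hf (hdz g),
    laurent_coeff_mul _ g _ _ _ (hdz f) hg, Finset.smul_sum,
    show n - (g.order - 1) = n + 1 - g.order by ring]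
  have hs : ∑ i ∈ Finset.Icc (f.order - 1) (n - g.order),
      (LaurentSeries.derivative ℤ f).coeff i * g.coeff (n - i) =
      ∑ i ∈ Finset.Icc f.order (n + 1 - g.order), (i • f.coeff i) * g.coeff (n + 1 - i) := by
    refine Finset.sum_bij (fun i _ => i + 1) ?_ ?_ ?_ ?_
    · intro i hi
      simp only [Finset.mem_Icc] at hi ⊢
      omega
    · intro i _ j _ h
      omega
    · intro j hj
      simp only [Finset.mem_Icc] at hj
      exact ⟨j - 1, by simp only [Finset.mem_Icc]; omega, by ring⟩
    · intro i _
      rw [hd, show n + 1 - (i + 1) = n - i by ring]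
  rw [hs, ← Finset.sum_add_distrib]
  refine Finset.sum_congr rfl fun i _ => ?_
  rw [hd, show n - i + 1 = n + 1 - i by ring]
  simp only [zsmul_eq_mul]
  push_cast
  ring

/-- Formal functions of `x` and `t = (t_1, t_2, …)`: power series in the variables `t_n`
(`n ≥ 1`) whose coefficients are Laurent series in `x` over `A`. This ring contains both
`A[[t]][[x]]` and `A[[t]]((x))`, see `powerFun` and `laurentFun`. -/
abbrev Fun (A : Type*) [CommRing A] := MvPowerSeries ℕ+ (LaurentSeries A)

/-- The derivative `∂/∂x` of `f ∈ Fun A`, acting on each coefficient in `t`. -/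
def xDeriv (A : Type*) [CommRing A] : Fun A →+ Fun A where
  toFun f := fun α => LaurentSeries.derivative ℤ (MvPowerSeries.coeff α f)
  map_zero' := by
    funext α
    exact map_zero (LaurentSeries.derivative ℤ)
  map_add' f g := by
    funext α
    exact map_add (LaurentSeries.derivative ℤ) _ _

theorem xDeriv_mul (f g : Fun A) : xDeriv A (f * g) = f * xDeriv A g + g * xDeriv A f := by
  classical
  ext1 α
  rw [map_add, mul_comm g, MvPowerSeries.coeff_mul, MvPowerSeries.coeff_mul,
    ← Finset.sum_add_distrib]
  change LaurentSeries.derivative ℤ (MvPowerSeries.coeff α (f * g)) = _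
  rw [MvPowerSeries.coeff_mul, map_sum]
  refine Finset.sum_congr rfl fun p _ => ?_
  rw [laurent_derivative_mul, mul_comm (MvPowerSeries.coeff p.2 g)]
  rfl

/-- An additive map that satisfies the Leibniz rule makes `R` a differential ring. -/
abbrev differentialOf {R : Type*} [CommRing R] (d : R →+ R)
    (hd : ∀ f g, d (f * g) = f * d g + g * d f) : Differential R :=
  ⟨Derivation.mk' d.toIntLinearMap hd⟩

/-- `Fun A` as a differential ring with `∂ = ∂/∂x`. -/
instance : Differential (Fun A) := differentialOf (xDeriv A) xDeriv_mul

/-- The derivation `∂/∂t_n` of `Fun A`. -/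
def tDeriv (n : ℕ+) : Derivation (LaurentSeries A) (Fun A) (Fun A) :=
  MvPowerSeries.pderiv (LaurentSeries A) n

/-- The operator `∂P/∂t_n`, obtained by differentiating the coefficients of `P`. -/
def opDeriv (n : ℕ+) (P : MicroDiff (Fun A)) : MicroDiff (Fun A) :=
  P.map (tDeriv n).toLinearMap.toAddMonoidHom

/-- An element of `A[[t]]`, regarded as a function of `x` and `t` that does not depend on `x`. -/
def ofTimes : MvPowerSeries ℕ+ A →+* Fun A := MvPowerSeries.map HahnSeries.C

/-- The ring `A[[t]]((x))` inside `Fun A`: the functions `∑_n g_n(t) x^n` for a Laurent series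
`g` in `x` with coefficients `g_n ∈ A[[t]]`. -/
def laurentFun (A : Type*) [CommRing A] : Set (Fun A) :=
  {f | ∃ g : LaurentSeries (MvPowerSeries ℕ+ A), ∀ α n,
    (MvPowerSeries.coeff α f).coeff n = MvPowerSeries.coeff α (g.coeff n)}

/-- The ring `A[[t]][[x]]` inside `Fun A`: the functions `∑_{n ≥ 0} g_n(t) x^n` for a power
series `g` in `x` with coefficients `g_n ∈ A[[t]]`. -/
def powerFun (A : Type*) [CommRing A] : Set (Fun A) :=
  {f | ∃ g : PowerSeries (MvPowerSeries ℕ+ A), ∀ α n,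
    (MvPowerSeries.coeff α f).coeff n =
      MvPowerSeries.coeff α ((HahnSeries.ofPowerSeries ℤ _ g).coeff n)}

/-- The exponential `e^f = ∑ f^k / k!`, which converges `t`-adically whenever `f` vanishes at
`t = 0`. -/
def expFun [Algebra ℂ A] (f : Fun A) : Fun A := PowerSeries.subst f (PowerSeries.exp ℂ)

/-- `t̃_n = t_n + O(t_{n+1}, t_{n+2}, …)` for all `n`: the difference `t̃_n - t_n` is a power
series in `t_{n+1}, t_{n+2}, …` without constant term. -/
def IsTriangular (τ : ℕ+ → MvPowerSeries ℕ+ A) : Prop :=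
  ∀ (n : ℕ+) (α : ℕ+ →₀ ℕ), MvPowerSeries.coeff α (τ n - MvPowerSeries.X n) ≠ 0 →
    α ≠ 0 ∧ ∀ m ∈ α.support, n < m

/-- `h(x, t) ↦ h(x, t̃(t))`: substitute the series `t̃_n = τ n` for the variables `t_n`. -/
def timeChange (τ : ℕ+ → MvPowerSeries ℕ+ A) (h : Fun A) : Fun A :=
  MvPowerSeries.subst (fun n => ofTimes (τ n)) h

/-- `∂f/∂t̃_n = f'` within the function ring `S`: expressing `f` through the new time variables
as `f(x, t) = h(x, t̃(t))` with `h ∈ S`, the function `f'` is the `n`-th partial derivative of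
`h`, evaluated at `t̃(t)`. When `timeChange τ` is a bijection of `S`, the function `h` exists and
is unique. -/
def HasNewTimeDeriv (S : Set (Fun A)) (τ : ℕ+ → MvPowerSeries ℕ+ A) (n : ℕ+) (f f' : Fun A) :
    Prop :=
  ∃ h ∈ S, timeChange τ h = f ∧ timeChange τ (tDeriv n h) = f'

/-- The Zakharov-Shabat equations `∂B_n/∂t_m - ∂B_m/∂t_n + [B_n, B_m] = 0`. -/
def ZakharovShabat (B : ℕ+ → MicroDiff (Fun A)) : Prop :=
  ∀ n m, opDeriv m (B n) - opDeriv n (B m) + (B n).comm (B m) = 0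

/-- The Lax equations `∂L/∂t̃_n = [(L^n)_+, L]` in the time variables `t̃ = τ`. -/
def LaxEquations (S : Set (Fun A)) (τ : ℕ+ → MvPowerSeries ℕ+ A) (L : MicroDiff (Fun A)) : Prop :=
  ∀ (n : ℕ+) (k : ℤ), HasNewTimeDeriv S τ n (L.coeff k) (((L ^ (n : ℕ)).plus.comm L).coeff k)

/-- `B̃_n = e^{f} (L^n)_+ e^{-f}`. -/
def tildeB [Algebra ℂ A] (f : Fun A) (L : MicroDiff (Fun A)) (n : ℕ+) : MicroDiff (Fun A) :=
  MicroDiff.ofFun (expFun f) * (L ^ (n : ℕ)).plus * MicroDiff.ofFun (expFun (-f))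

end Functions

end KP

end

/-!
Write `D_n P = ∂P/∂t_n - [B_n, P]`. The Zakharov-Shabat equations make the `D_n` commute, and an
approximate `m`-th root of `B_m` solves `D_n X = 0` up to an error whose order tends to `-∞` with
`m`. Two such roots differ by a series in powers of either one with `x`-independent coefficients,
and the equations force these coefficients to depend on higher and higher times only. Replacing
the coefficients by their values at `t = 0` therefore makes the roots converge, to a monic
first-order `X` with `D_n X = 0` for all `n`.

Expanding `B_n = ∑_{k ≥ 1} g_{n,k} X^k + Z_n` with `x`-independent `g_{n,k}` and `Z_n` of order `0`,
the Zakharov-Shabat equations say that the 1-forms `∑ g_{n,k} dt_n` and `∑ (Z_n)_0 dt_n` are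
closed. Their potentials are the new times `t̃_k` and the function `f₀`, and
`L = e^{-f₀} X e^{f₀}`. The Lax equations then follow from the chain rule, solved recursively in
`n`. The remaining freedom in `X` is used to make its coefficient of `∂^0` vanish at
`(t, x) = (0, 0)`, from which part 3 follows.
-/

noncomputable section

namespace KP

open Finset
open scoped Differential

namespace MicroDiff

/-! ### The ring of microdifferential operators -/

section Coefficients

variable {R : Type*} [AddCommGroup R]

@[ext]
theorem ext {P Q : MicroDiff R} (h : ∀ k, P.coeff k = Q.coeff k) : P = Q :=
  Subtype.ext (funext h)

variable (R) in
/-- The coefficient of `∂^k` as an additive map. -/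
def coeffHom (k : ℤ) : MicroDiff R →+ R where
  toFun P := P.coeff k
  map_zero' := rfl
  map_add' _ _ := rfl

@[simp] theorem coeffHom_apply (k : ℤ) (P : MicroDiff R) : coeffHom R k P = P.coeff k := rfl

@[simp] theorem coeff_add (P Q : MicroDiff R) (k : ℤ) :
    (P + Q).coeff k = P.coeff k + Q.coeff k := rfl

@[simp] theorem coeff_sub (P Q : MicroDiff R) (k : ℤ) :
    (P - Q).coeff k = P.coeff k - Q.coeff k := rfl

@[simp] theorem coeff_neg (P : MicroDiff R) (k : ℤ) : (-P).coeff k = -P.coeff k := rfl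

@[simp] theorem coeff_zero (k : ℤ) : (0 : MicroDiff R).coeff k = 0 := rfl

theorem coeff_sum {ι : Type*} (s : Finset ι) (P : ι → MicroDiff R) (k : ℤ) :
    (∑ i ∈ s, P i).coeff k = ∑ i ∈ s, (P i).coeff k :=
  map_sum (coeffHom R k) P s

theorem coeff_map (φ : R →+ R) (P : MicroDiff R) (k : ℤ) :
    (P.map φ).coeff k = φ (P.coeff k) := rfl

theorem coeff_plus (P : MicroDiff R) (k : ℤ) :
    P.plus.coeff k = if 0 ≤ k then P.coeff k else 0 := rfl

theorem coeff_ofFun (c : R) (k : ℤ) : (ofFun c).coeff k = if k = 0 then c else 0 := rfl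

/-- The operator `a ∂^l`. -/
def monomial (l : ℤ) (a : R) : MicroDiff R :=
  ⟨fun k => if k = l then a else 0, ⟨l, fun _ hk => if_neg hk.ne'⟩⟩

theorem coeff_monomial (l : ℤ) (a : R) (k : ℤ) :
    (monomial l a).coeff k = if k = l then a else 0 := rfl

variable (R) in
/-- The operators of order at most `N`. They form a filtration of `MicroDiff R`. -/
def orderLE (N : ℤ) : AddSubgroup (MicroDiff R) := ⨅ k > N, (coeffHom R k).ker

theorem mem_orderLE {P : MicroDiff R} {N : ℤ} :
    P ∈ orderLE R N ↔ ∀ k, N < k → P.coeff k = 0 := by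
  simp [orderLE, AddSubgroup.mem_iInf]

theorem exists_mem_orderLE (P : MicroDiff R) : ∃ N, P ∈ orderLE R N :=
  P.2.imp fun _ => mem_orderLE.2

theorem orderLE_mono {N M : ℤ} (h : N ≤ M) : orderLE R N ≤ orderLE R M := fun _ hP =>
  mem_orderLE.2 fun k hk => mem_orderLE.1 hP k (h.trans_lt hk)

theorem mem_orderLE_sub_one {P : MicroDiff R} {N : ℤ} (hP : P ∈ orderLE R N)
    (h : P.coeff N = 0) : P ∈ orderLE R (N - 1) :=
  mem_orderLE.2 fun k hk => by
    rcases eq_or_ne k N with rfl | hne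
    · exact h
    · exact mem_orderLE.1 hP k (by omega)

theorem eq_zero_of_forall_mem_orderLE {P : MicroDiff R} (h : ∀ n : ℕ, P ∈ orderLE R (-n)) :
    P = 0 :=
  ext fun k => mem_orderLE.1 (h (k.natAbs + 1)) k (by omega)

theorem mem_orderLE_of_forall_coeff_eq_zero {P : MicroDiff R} {N : ℤ}
    (h : ∀ d, N < d → P ∈ orderLE R d → P.coeff d = 0) : P ∈ orderLE R N := by
  obtain ⟨M, hM⟩ := P.exists_mem_orderLE
  have key (j : ℕ) : P ∈ orderLE R (max N (M - j)) := by
    induction j with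
    | zero => exact orderLE_mono (by simp) hM
    | succ j ih =>
      by_cases hj : N < M - j
      · rw [max_eq_right hj.le] at ih
        exact orderLE_mono (by push_cast; omega) (mem_orderLE_sub_one ih (h _ hj ih))
      · exact orderLE_mono (by push_cast; omega) ih
  exact orderLE_mono (by omega) (key (M - N).toNat)

theorem monomial_mem_orderLE (l : ℤ) (a : R) : monomial l a ∈ orderLE R l :=
  mem_orderLE.2 fun _ hk => if_neg hk.ne'

theorem ofFun_mem_orderLE (c : R) : ofFun c ∈ orderLE R 0 := monomial_mem_orderLE 0 c

theorem exists_sub_sum_monomial_mem_orderLE (P : MicroDiff R) (K : ℤ) :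
    ∃ s : Finset ℤ, P - ∑ l ∈ s, monomial l (P.coeff l) ∈ orderLE R K := by
  obtain ⟨N, hN⟩ := P.exists_mem_orderLE
  refine ⟨Icc K N, mem_orderLE.2 fun k hk => ?_⟩
  simp only [coeff_sub, coeff_sum, coeff_monomial, sum_ite_eq, mem_Icc]
  split_ifs with h
  · exact sub_self _
  · rw [mem_orderLE.1 hN k (by omega), sub_zero]

theorem apply_eq_of_eq_monomial {G : Type*} [AddCommGroup G] {φ ψ : MicroDiff R →+ G} (K : ℤ)
    (hK : ∀ P ∈ orderLE R K, φ P = ψ P) (h : ∀ l a, φ (monomial l a) = ψ (monomial l a))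
    (P : MicroDiff R) : φ P = ψ P := by
  obtain ⟨s, hs⟩ := P.exists_sub_sum_monomial_mem_orderLE K
  have hsum : φ (∑ l ∈ s, monomial l (P.coeff l)) = ψ (∑ l ∈ s, monomial l (P.coeff l)) := by
    simp only [map_sum, h]
  simpa only [map_sub, hsum, sub_left_inj] using hK _ hs

end Coefficients

section Product

variable {R : Type*} [CommRing R] [Differential R]

variable (R) in
/-- The `r`-th derivative. -/
def iterDeriv (r : ℕ) : AddMonoid.End R :=
  (show AddMonoid.End R from
    (Differential.deriv : Derivation ℤ R R).toLinearMap.toAddMonoidHom) ^ r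

@[simp] theorem iterDeriv_zero (a : R) : iterDeriv R 0 a = a := rfl

@[simp] theorem iterDeriv_one (a : R) : iterDeriv R 1 a = a′ := by
  rw [iterDeriv, pow_one]
  rfl

theorem iterDeriv_add (r s : ℕ) (a : R) :
    iterDeriv R (r + s) a = iterDeriv R r (iterDeriv R s a) := by
  rw [iterDeriv, pow_add]
  rfl

theorem iterDeriv_succ (r : ℕ) (a : R) : iterDeriv R (r + 1) a = (iterDeriv R r a)′ := by
  rw [add_comm, iterDeriv_add, iterDeriv_one]

theorem iterDeriv_eq_zero {r : ℕ} (hr : r ≠ 0) {a : R} (ha : a′ = 0) : iterDeriv R r a = 0 := by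
  obtain ⟨r, rfl⟩ := Nat.exists_eq_succ_of_ne_zero hr
  rw [Nat.succ_eq_add_one, iterDeriv_add, iterDeriv_one, ha, map_zero]

theorem iterDeriv_mul (r : ℕ) (a b : R) :
    iterDeriv R r (a * b) =
      ∑ p ∈ antidiagonal r, r.choose p.1 • (iterDeriv R p.1 a * iterDeriv R p.2 b) := by
  induction r with
  | zero => simp
  | succ r ih =>
    rw [iterDeriv_succ, ih, map_sum,
      sum_antidiagonal_choose_succ_nsmul (fun i j => iterDeriv R i a * iterDeriv R j b),
      ← sum_add_distrib]
    refine sum_congr rfl fun p hp => ?_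
    rw [HasAntidiagonal.mem_antidiagonal] at hp
    rw [map_nsmul, Derivation.leibniz, smul_eq_mul, smul_eq_mul, ← iterDeriv_succ,
      ← iterDeriv_succ, smul_add, mul_comm (iterDeriv R p.2 b), ← hp, Nat.choose_symm_add]

theorem coeff_mul (P Q : MicroDiff R) (k : ℤ) : (P * Q).coeff k =
    ∑ᶠ p : ℤ × ℕ,
      Ring.choose p.1 p.2 • (P.coeff p.1 * iterDeriv R p.2 (Q.coeff (k - p.1 + p.2))) := rfl

theorem support_coeff_mul_subset {P Q : MicroDiff R} {N M : ℤ} (hP : P ∈ orderLE R N)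
    (hQ : Q ∈ orderLE R M) (q : ℕ) :
    (Function.support fun p : ℤ × ℕ => Ring.choose p.1 p.2 •
      (P.coeff p.1 * iterDeriv R p.2 (Q.coeff (N + M - q - p.1 + p.2)))) ⊆
    ((antidiagonal q).sigma (fun v => antidiagonal v.2)).image
      (fun v => ((N - v.1.1, v.2.1) : ℤ × ℕ)) := by
  rintro ⟨l, r⟩ h
  rw [Function.mem_support] at h
  have hl : l ≤ N := not_lt.1 fun hl => h (by simp [mem_orderLE.1 hP l hl])
  have hr : N + M - q - l + r ≤ M := not_lt.1 fun hr => h (by simp [mem_orderLE.1 hQ _ hr])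
  simp only [coe_image, Set.mem_image, mem_coe, mem_sigma, HasAntidiagonal.mem_antidiagonal,
    Prod.mk.injEq]
  exact ⟨⟨((N - l).toNat, q - (N - l).toNat), (r, q - (N - l).toNat - r)⟩,
    ⟨by simp only; omega, by simp only; omega⟩, by simp only; omega, rfl⟩

theorem finite_support_coeff_mul (P Q : MicroDiff R) (k : ℤ) :
    (Function.support fun p : ℤ × ℕ => Ring.choose p.1 p.2 •
      (P.coeff p.1 * iterDeriv R p.2 (Q.coeff (k - p.1 + p.2)))).Finite := by
  obtain ⟨N, hN⟩ := P.exists_mem_orderLE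
  obtain ⟨M, hM⟩ := Q.exists_mem_orderLE
  obtain ⟨q, hq⟩ : ∃ q : ℕ, N + max M (k - N) - q = k :=
    ⟨(N + max M (k - N) - k).toNat, by omega⟩
  have h := support_coeff_mul_subset hN (orderLE_mono (le_max_left M (k - N)) hM) q
  rw [hq] at h
  exact (finite_toSet _).subset h

theorem coeff_mul_sub {P Q : MicroDiff R} {N M : ℤ} (hP : P ∈ orderLE R N)
    (hQ : Q ∈ orderLE R M) (q : ℕ) :
    (P * Q).coeff (N + M - q) = ∑ v ∈ antidiagonal q, ∑ w ∈ antidiagonal v.2,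
      Ring.choose (N - v.1) w.1 •
        (P.coeff (N - v.1) * iterDeriv R w.1 (Q.coeff (M - w.2))) := by
  rw [coeff_mul, finsum_eq_sum_of_support_subset _ (support_coeff_mul_subset hP hQ q),
    sum_image, sum_sigma]
  · refine sum_congr rfl fun v hv => sum_congr rfl fun w hw => ?_
    rw [HasAntidiagonal.mem_antidiagonal] at hv hw
    rw [show N + M - (q : ℤ) - (N - (v.1 : ℤ)) + (w.1 : ℤ) = M - w.2 by omega]
  · rintro ⟨⟨a, b⟩, ⟨c, d⟩⟩ h ⟨⟨a', b'⟩, ⟨c', d'⟩⟩ h' e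
    simp only [mem_coe, mem_sigma, HasAntidiagonal.mem_antidiagonal, Prod.mk.injEq] at h h' e
    obtain ⟨rfl, rfl⟩ : a = a' ∧ c = c' := by omega
    obtain rfl : b = b' := by omega
    obtain rfl : d = d' := by omega
    rfl

theorem mul_mem_orderLE {P Q : MicroDiff R} {N M : ℤ} (hP : P ∈ orderLE R N)
    (hQ : Q ∈ orderLE R M) : P * Q ∈ orderLE R (N + M) :=
  mem_orderLE.2 fun k hk => by
    rw [coeff_mul]
    refine finsum_eq_zero_of_forall_eq_zero fun p => ?_
    by_cases hp : N < p.1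
    · simp [mem_orderLE.1 hP p.1 hp]
    · simp [mem_orderLE.1 hQ (k - p.1 + p.2) (by omega)]

theorem coeff_mul_top {P Q : MicroDiff R} {N M : ℤ} (hP : P ∈ orderLE R N)
    (hQ : Q ∈ orderLE R M) : (P * Q).coeff (N + M) = P.coeff N * Q.coeff M := by
  simpa using coeff_mul_sub hP hQ 0

theorem coeff_mul_sub_one {P Q : MicroDiff R} {N M : ℤ} (hP : P ∈ orderLE R N)
    (hQ : Q ∈ orderLE R M) :
    (P * Q).coeff (N + M - 1) =
      P.coeff N * Q.coeff (M - 1) + N • (P.coeff N * (Q.coeff M)′) +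
        P.coeff (N - 1) * Q.coeff M := by
  simpa [Nat.antidiagonal_succ] using coeff_mul_sub hP hQ 1

scoped instance : NonUnitalNonAssocRing (MicroDiff R) where
  left_distrib P Q Q' := by
    ext k
    rw [coeff_add, coeff_mul, coeff_mul, coeff_mul,
      ← finsum_add_distrib (finite_support_coeff_mul P Q k) (finite_support_coeff_mul P Q' k)]
    exact finsum_congr fun p => by rw [coeff_add, map_add, mul_add, smul_add]
  right_distrib P P' Q := by
    ext k
    rw [coeff_add, coeff_mul, coeff_mul, coeff_mul,
      ← finsum_add_distrib (finite_support_coeff_mul P Q k) (finite_support_coeff_mul P' Q k)]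
    exact finsum_congr fun p => by rw [coeff_add, add_mul, smul_add]
  zero_mul P := ext fun k => by simp [coeff_mul]
  mul_zero P := ext fun k => by simp [coeff_mul]

theorem coeff_monomial_mul_sub (a : R) (l : ℤ) {Q : MicroDiff R} {M : ℤ} (hQ : Q ∈ orderLE R M)
    (q : ℕ) :
    (monomial l a * Q).coeff (l + M - q) = ∑ w ∈ antidiagonal q,
      Ring.choose l w.1 • (a * iterDeriv R w.1 (Q.coeff (M - w.2))) := by
  rw [coeff_mul_sub (monomial_mem_orderLE l a) hQ,
    sum_eq_single_of_mem (0, q) (by simp) fun v hv hne => ?_]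
  · simp [coeff_monomial]
  · have hv1 : v.1 ≠ 0 := fun h => hne (Prod.ext h (by simp_all))
    simp [coeff_monomial, hv1]

theorem coeff_mul_monomial_sub {P : MicroDiff R} {N : ℤ} (hP : P ∈ orderLE R N) (m : ℤ) (c : R)
    (q : ℕ) :
    (P * monomial m c).coeff (N + m - q) = ∑ v ∈ antidiagonal q,
      Ring.choose (N - v.1) v.2 • (P.coeff (N - v.1) * iterDeriv R v.2 c) := by
  rw [coeff_mul_sub hP (monomial_mem_orderLE m c)]
  refine sum_congr rfl fun v _ => ?_
  rw [sum_eq_single_of_mem (v.2, 0) (by simp) fun w hw hne => ?_]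
  · simp [coeff_monomial]
  · have hw2 : w.2 ≠ 0 := fun h => hne (Prod.ext (by simp_all) h)
    simp [coeff_monomial, hw2]

theorem coeff_monomial_mul_monomial (a b : R) (l m : ℤ) (q : ℕ) :
    (monomial l a * monomial m b).coeff (l + m - q) =
      Ring.choose l q • (a * iterDeriv R q b) := by
  rw [coeff_monomial_mul_sub a l (monomial_mem_orderLE m b),
    sum_eq_single_of_mem (q, 0) (by simp) fun w hw hne => ?_]
  · simp [coeff_monomial]
  · have hw2 : w.2 ≠ 0 := fun h => hne (Prod.ext (by simp_all) h)
    simp [coeff_monomial, hw2]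

theorem choose_add_sub_mul_choose (l m : ℤ) (r s : ℕ) :
    Ring.choose (l + m - r) s * Ring.choose l r = ∑ p ∈ antidiagonal s,
      Ring.choose l (r + p.1) * Ring.choose m p.2 * ((r + p.1).choose r : ℤ) := by
  rw [show l + m - r = (l - r) + m by ring, Ring.add_choose_eq s (Commute.all _ _), sum_mul]
  refine sum_congr rfl fun p _ => ?_
  have h := Ring.choose_smul_choose l (Nat.le_add_right r p.1)
  rw [Nat.add_sub_cancel_left, nsmul_eq_mul] at h
  linear_combination (-Ring.choose m p.2) * h

theorem sum_antidiagonal_snd_eq_sum_antidiagonal_fst {M : Type*} [AddCommMonoid M] (n : ℕ)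
    (f : ℕ → ℕ → ℕ → M) :
    ∑ v ∈ antidiagonal n, ∑ p ∈ antidiagonal v.2, f v.1 p.1 p.2 =
      ∑ w ∈ antidiagonal n, ∑ p ∈ antidiagonal w.1, f p.1 p.2 w.2 := by
  simp only [sum_sigma']
  apply sum_nbij' (fun ⟨⟨i, _⟩, ⟨k, l⟩⟩ => ⟨(i + k, l), (i, k)⟩)
    (fun ⟨⟨_, j⟩, ⟨k, l⟩⟩ => ⟨(k, l + j), (l, j)⟩) <;>
  · simp only [mem_sigma, HasAntidiagonal.mem_antidiagonal]
    rintro ⟨⟨i, j⟩, ⟨k, l⟩⟩ h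
    obtain ⟨rfl, rfl⟩ : i + j = n ∧ k + l = _ := h
    simp [add_assoc]

/-- The coefficient of `a b^{(i)} c^{(j + k)}` in both of the products `(a ∂^l b ∂^m) c ∂^n` and
`a ∂^l (b ∂^m c ∂^n)`. -/
def tripleChoose (l m : ℤ) (i j k : ℕ) : ℤ :=
  Ring.choose l (i + j) * Ring.choose m k * ((i + j).choose i : ℤ)

theorem coeff_monomial_mul_monomial_mul_monomial (a b c : R) (l m n : ℤ) (q : ℕ) :
    (monomial l a * monomial m b * monomial n c).coeff (l + m + n - q) =
      ∑ v ∈ antidiagonal q, ∑ p ∈ antidiagonal v.2,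
        tripleChoose l m v.1 p.1 p.2 • (a * iterDeriv R v.1 b * iterDeriv R (p.1 + p.2) c) := by
  rw [coeff_mul_monomial_sub
    (mul_mem_orderLE (monomial_mem_orderLE l a) (monomial_mem_orderLE m b))]
  refine sum_congr rfl fun v _ => ?_
  rw [coeff_monomial_mul_monomial, smul_mul_assoc, smul_smul, choose_add_sub_mul_choose, sum_smul]
  refine sum_congr rfl fun p hp => ?_
  rw [HasAntidiagonal.mem_antidiagonal.1 hp, tripleChoose]

theorem coeff_monomial_mul_mul_monomial (a b c : R) (l m n : ℤ) (q : ℕ) :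
    (monomial l a * (monomial m b * monomial n c)).coeff (l + m + n - q) =
      ∑ w ∈ antidiagonal q, ∑ p ∈ antidiagonal w.1,
        tripleChoose l m p.1 p.2 w.2 • (a * iterDeriv R p.1 b * iterDeriv R (p.2 + w.2) c) := by
  rw [add_assoc, coeff_monomial_mul_sub a l
    (mul_mem_orderLE (monomial_mem_orderLE m b) (monomial_mem_orderLE n c))]
  refine sum_congr rfl fun w _ => ?_
  rw [coeff_monomial_mul_monomial, map_zsmul, iterDeriv_mul, mul_smul_comm, mul_sum, smul_sum,
    smul_sum]
  refine sum_congr rfl fun p hp => ?_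
  rw [tripleChoose, HasAntidiagonal.mem_antidiagonal.1 hp, ← iterDeriv_add]
  simp only [zsmul_eq_mul, nsmul_eq_mul]
  push_cast
  ring

theorem coeff_mul_mul_eq_zero {P Q T : MicroDiff R} {N M K k : ℤ} (hP : P ∈ orderLE R N)
    (hQ : Q ∈ orderLE R M) (hT : T ∈ orderLE R K) (hk : N + M + K < k) :
    (P * Q * T).coeff k = 0 ∧ (P * (Q * T)).coeff k = 0 :=
  ⟨mem_orderLE.1 (mul_mem_orderLE (mul_mem_orderLE hP hQ) hT) k hk,
    mem_orderLE.1 (mul_mem_orderLE hP (mul_mem_orderLE hQ hT)) k (by omega)⟩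

theorem monomial_mul_assoc (a b c : R) (l m n : ℤ) :
    monomial l a * monomial m b * monomial n c =
      monomial l a * (monomial m b * monomial n c) := by
  ext k
  by_cases hk : l + m + n < k
  · obtain ⟨h, h'⟩ := coeff_mul_mul_eq_zero (monomial_mem_orderLE l a) (monomial_mem_orderLE m b)
      (monomial_mem_orderLE n c) hk
    rw [h, h']
  · obtain ⟨q, rfl⟩ : ∃ q : ℕ, k = l + m + n - q := ⟨(l + m + n - k).toNat, by omega⟩
    rw [coeff_monomial_mul_monomial_mul_monomial, coeff_monomial_mul_mul_monomial,
      sum_antidiagonal_snd_eq_sum_antidiagonal_fst q fun i j k =>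
        tripleChoose l m i j k • (a * iterDeriv R i b * iterDeriv R (j + k) c)]

open AddMonoidHom (mulLeft mulRight) in
protected theorem mul_assoc (P Q T : MicroDiff R) : P * Q * T = P * (Q * T) := by
  ext k
  obtain ⟨N, hN⟩ := P.exists_mem_orderLE
  obtain ⟨M, hM⟩ := Q.exists_mem_orderLE
  refine apply_eq_of_eq_monomial (φ := (coeffHom R k).comp (mulLeft (P * Q)))
    (ψ := (coeffHom R k).comp ((mulLeft P).comp (mulLeft Q))) (k - 1 - N - M)
    (fun T hT => ?_) (fun n c => ?_) T
  · obtain ⟨h, h'⟩ := coeff_mul_mul_eq_zero (k := k) hN hM hT (by omega)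
    exact h.trans h'.symm
  refine apply_eq_of_eq_monomial
    (φ := (coeffHom R k).comp ((mulRight (monomial n c)).comp (mulLeft P)))
    (ψ := (coeffHom R k).comp ((mulLeft P).comp (mulRight (monomial n c)))) (k - 1 - N - n)
    (fun Q hQ => ?_) (fun m b => ?_) Q
  · obtain ⟨h, h'⟩ := coeff_mul_mul_eq_zero (k := k) hN hQ (monomial_mem_orderLE n c) (by omega)
    exact h.trans h'.symm
  refine apply_eq_of_eq_monomial
    (φ := (coeffHom R k).comp ((mulRight (monomial n c)).comp (mulRight (monomial m b))))
    (ψ := (coeffHom R k).comp (mulRight (monomial m b * monomial n c))) (k - 1 - m - n)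
    (fun P hP => ?_) (fun l a => ?_) P
  · obtain ⟨h, h'⟩ := coeff_mul_mul_eq_zero (k := k) hP (monomial_mem_orderLE m b)
      (monomial_mem_orderLE n c) (by omega)
    exact h.trans h'.symm
  · exact congrArg (coeffHom R k) (monomial_mul_assoc a b c l m n)

theorem coeff_ofFun_mul (c : R) (Q : MicroDiff R) (k : ℤ) :
    (ofFun c * Q).coeff k = c * Q.coeff k := by
  rw [coeff_mul, finsum_eq_single _ (0, 0)]
  · simp [coeff_ofFun]
  · rintro ⟨l, r⟩ hne
    by_cases hl : l = 0
    · subst hl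
      have hr : 0 < r := Nat.pos_of_ne_zero (by rintro rfl; exact hne rfl)
      simp [Ring.choose_zero_pos ℤ hr]
    · simp [coeff_ofFun, hl]

theorem coeff_mul_ofFun {c : R} (hc : c′ = 0) (P : MicroDiff R) (k : ℤ) :
    (P * ofFun c).coeff k = c * P.coeff k := by
  rw [coeff_mul, finsum_eq_single _ (k, 0)]
  · simp [coeff_ofFun, mul_comm]
  · rintro ⟨l, r⟩ hne
    by_cases hl : k - l + r = 0
    · have hr : r ≠ 0 := by
        rintro rfl
        exact hne (by simp only [Prod.mk.injEq, and_true]; push_cast at hl; omega)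
      simp [coeff_ofFun, hl, iterDeriv_eq_zero hr hc]
    · simp [coeff_ofFun, hl]

scoped instance : Ring (MicroDiff R) :=
  { (inferInstance : NonUnitalNonAssocRing (MicroDiff R)) with
    mul_assoc := MicroDiff.mul_assoc
    one_mul := fun Q => ext fun k => (coeff_ofFun_mul 1 Q k).trans (one_mul _)
    mul_one := fun Q => ext fun k =>
      (coeff_mul_ofFun (Derivation.map_one_eq_zero _) Q k).trans (one_mul _)
    npow := fun n P => P ^ n
    npow_zero := fun _ => rfl
    npow_succ := fun _ _ => rfl }

end Product

section Plus

variable {R : Type*} [AddCommGroup R]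

theorem plus_add (P Q : MicroDiff R) : (P + Q).plus = P.plus + Q.plus := by
  ext k
  simp only [coeff_plus, coeff_add]
  split_ifs <;> simp

theorem plus_sum {ι : Type*} (s : Finset ι) (P : ι → MicroDiff R) :
    (∑ i ∈ s, P i).plus = ∑ i ∈ s, (P i).plus :=
  map_sum (AddMonoidHom.mk' plus plus_add) P s

theorem plus_eq_zero {P : MicroDiff R} (hP : P ∈ orderLE R (-1)) : P.plus = 0 := by
  ext k
  rw [coeff_plus]
  split_ifs with h
  · exact mem_orderLE.1 hP k (by omega)
  · rfl

theorem sub_plus_mem_orderLE (P : MicroDiff R) : P - P.plus ∈ orderLE R (-1) :=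
  mem_orderLE.2 fun k hk => by rw [coeff_sub, coeff_plus, if_pos (by omega), sub_self]

end Plus

section Monic

variable {R : Type*} [CommRing R]

theorem coeff_one (k : ℤ) : (1 : MicroDiff R).coeff k = if k = 0 then 1 else 0 := rfl

theorem ofFun_one : ofFun (1 : R) = 1 := rfl

theorem one_mem_orderLE : (1 : MicroDiff R) ∈ orderLE R 0 := ofFun_mem_orderLE 1

theorem isMonic_iff {P : MicroDiff R} {N : ℤ} :
    P.IsMonic N ↔ P.coeff N = 1 ∧ P ∈ orderLE R N := by
  rw [IsMonic, mem_orderLE]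

theorem IsMonic.mem_orderLE {P : MicroDiff R} {N : ℤ} (h : P.IsMonic N) : P ∈ orderLE R N :=
  (isMonic_iff.1 h).2

theorem isMonic_one : (1 : MicroDiff R).IsMonic 0 := isMonic_iff.2 ⟨rfl, one_mem_orderLE⟩

theorem isMonic_monomial (l : ℤ) : (monomial l (1 : R)).IsMonic l :=
  isMonic_iff.2 ⟨if_pos rfl, monomial_mem_orderLE l 1⟩

theorem IsMonic.sub_mem_orderLE {P Q : MicroDiff R} {N : ℤ} (hP : P.IsMonic N)
    (hQ : Q.IsMonic N) : P - Q ∈ orderLE R (N - 1) :=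
  mem_orderLE_sub_one (sub_mem hP.mem_orderLE hQ.mem_orderLE)
    (by rw [coeff_sub, hP.1, hQ.1, sub_self])

theorem IsMonic.add {P X : MicroDiff R} {N M : ℤ} (hP : P.IsMonic N) (hX : X ∈ orderLE R M)
    (hMN : M < N) : (P + X).IsMonic N :=
  isMonic_iff.2 ⟨by rw [coeff_add, hP.1, MicroDiff.mem_orderLE.1 hX N hMN, add_zero],
    add_mem hP.mem_orderLE (orderLE_mono hMN.le hX)⟩

theorem isDifferential_plus (P : MicroDiff R) : P.plus.IsDifferential := fun k hk => by
  rw [coeff_plus, if_neg (not_le.2 hk)]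

theorem isDifferential_ofFun (c : R) : (ofFun c).IsDifferential := fun k hk => by
  rw [coeff_ofFun, if_neg hk.ne]

theorem IsDifferential.plus_eq {P : MicroDiff R} (hP : P.IsDifferential) : P.plus = P := by
  ext k
  rw [coeff_plus]
  split_ifs with h
  · rfl
  · exact (hP k (not_le.1 h)).symm

end Monic

section Algebra

variable {R : Type*} [CommRing R] [Differential R]

variable (R) in
/-- Multiplication operators, as a ring homomorphism. -/
def ofFunHom : R →+* MicroDiff R where
  toFun := ofFun
  map_zero' := by ext k; simp [coeff_ofFun]
  map_one' := rfl
  map_add' a b := by ext k; simp only [coeff_ofFun, coeff_add]; split_ifs <;> simp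
  map_mul' a b := by
    ext k
    rw [coeff_ofFun_mul, coeff_ofFun, coeff_ofFun, mul_ite, mul_zero]

theorem ofFun_mul (a b : R) : ofFun (a * b) = ofFun a * ofFun b := map_mul (ofFunHom R) a b

theorem ofFun_sub (a b : R) : ofFun (a - b) = ofFun a - ofFun b := map_sub (ofFunHom R) a b

theorem ofFun_zero : ofFun (0 : R) = 0 := map_zero (ofFunHom R)

theorem ofFun_mul_comm {c : R} (hc : c′ = 0) (P : MicroDiff R) : ofFun c * P = P * ofFun c := by
  ext k
  rw [coeff_ofFun_mul, coeff_mul_ofFun hc]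

theorem ofFun_mul_mem_orderLE (c : R) {P : MicroDiff R} {N : ℤ} (hP : P ∈ orderLE R N) :
    ofFun c * P ∈ orderLE R N := by
  simpa using mul_mem_orderLE (ofFun_mem_orderLE c) hP

theorem pow_mem_orderLE {P : MicroDiff R} {N : ℤ} (hP : P ∈ orderLE R N) (n : ℕ) :
    P ^ n ∈ orderLE R (n * N) := by
  induction n with
  | zero => simpa using one_mem_orderLE
  | succ n ih =>
    rw [pow_succ]
    exact orderLE_mono (by push_cast; linarith) (mul_mem_orderLE ih hP)

theorem IsMonic.mul {P Q : MicroDiff R} {N M : ℤ} (hP : P.IsMonic N) (hQ : Q.IsMonic M) :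
    (P * Q).IsMonic (N + M) :=
  isMonic_iff.2 ⟨by rw [coeff_mul_top hP.mem_orderLE hQ.mem_orderLE, hP.1, hQ.1, mul_one],
    mul_mem_orderLE hP.mem_orderLE hQ.mem_orderLE⟩

theorem IsMonic.pow {P : MicroDiff R} (hP : P.IsMonic 1) (n : ℕ) : (P ^ n).IsMonic n := by
  induction n with
  | zero => simpa using isMonic_one
  | succ n ih =>
    rw [pow_succ]
    exact_mod_cast ih.mul hP

theorem IsMonic.coeff_pow_sub_one {P : MicroDiff R} (hP : P.IsMonic 1) (n : ℕ) :
    (P ^ n).coeff (n - 1) = n * P.coeff 0 := by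
  induction n with
  | zero => simp [coeff_one]
  | succ n ih =>
    rw [pow_succ, show ((n + 1 : ℕ) : ℤ) - 1 = n + 1 - 1 by push_cast; ring,
      coeff_mul_sub_one (hP.pow n).mem_orderLE hP.mem_orderLE, ih, hP.1, (hP.pow n).1, sub_self,
      Derivation.map_one_eq_zero]
    push_cast
    ring

theorem comm_mem_orderLE {P Q : MicroDiff R} {N M : ℤ} (hP : P ∈ orderLE R N)
    (hQ : Q ∈ orderLE R M) : P.comm Q ∈ orderLE R (N + M - 1) := by
  have hQP := mul_mem_orderLE hQ hP
  rw [add_comm] at hQP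
  refine mem_orderLE_sub_one (sub_mem (mul_mem_orderLE hP hQ) hQP) ?_
  rw [comm, coeff_sub, coeff_mul_top hP hQ, add_comm, coeff_mul_top hQ hP, mul_comm, sub_self]

theorem coeff_comm_top {P Q : MicroDiff R} {N M : ℤ} (hP : P ∈ orderLE R N)
    (hQ : Q ∈ orderLE R M) :
    (P.comm Q).coeff (N + M - 1) =
      N • (P.coeff N * (Q.coeff M)′) - M • (Q.coeff M * (P.coeff N)′) := by
  rw [comm, coeff_sub, coeff_mul_sub_one hP hQ, add_comm N M, coeff_mul_sub_one hQ hP]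
  simp only [zsmul_eq_mul]
  ring

theorem IsMonic.coeff_comm {P Q : MicroDiff R} {N M : ℤ} (hP : P.IsMonic N)
    (hQ : Q ∈ orderLE R M) : (P.comm Q).coeff (N + M - 1) = N • (Q.coeff M)′ := by
  rw [coeff_comm_top hP.mem_orderLE hQ, hP.1, Derivation.map_one_eq_zero, mul_zero, smul_zero,
    sub_zero, one_mul]

theorem IsDifferential.mul {P Q : MicroDiff R} (hP : P.IsDifferential) (hQ : Q.IsDifferential) :
    (P * Q).IsDifferential := fun k hk => by
  rw [coeff_mul]
  refine finsum_eq_zero_of_forall_eq_zero fun p => ?_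
  by_cases hp : p.1 < 0
  · rw [hP _ hp, zero_mul, smul_zero]
  by_cases hq : k - p.1 + p.2 < 0
  · rw [hQ _ hq, map_zero, mul_zero, smul_zero]
  obtain ⟨l, hl⟩ := Int.eq_ofNat_of_zero_le (not_lt.1 hp)
  rw [hl, Ring.choose_natCast, Nat.choose_eq_zero_of_lt (by omega), Nat.cast_zero, zero_smul]

theorem plus_ofFun_mul (c : R) (P : MicroDiff R) : (ofFun c * P).plus = ofFun c * P.plus := by
  ext k
  simp only [coeff_plus, coeff_ofFun_mul, mul_ite, mul_zero]

theorem plus_ofFun_mul_mul_ofFun (a b : R) (P : MicroDiff R) :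
    (ofFun a * P * ofFun b).plus = ofFun a * P.plus * ofFun b := by
  have hdiff : (ofFun a * P.plus * ofFun b).IsDifferential :=
    ((isDifferential_ofFun a).mul (isDifferential_plus P)).mul (isDifferential_ofFun b)
  have hneg : (ofFun a * (P - P.plus) * ofFun b).plus = 0 := plus_eq_zero <| by
    simpa using mul_mem_orderLE (ofFun_mul_mem_orderLE a (sub_plus_mem_orderLE P))
      (ofFun_mem_orderLE b)
  calc (ofFun a * P * ofFun b).plus
      = (ofFun a * P.plus * ofFun b + ofFun a * (P - P.plus) * ofFun b).plus := by noncomm_ring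
    _ = ofFun a * P.plus * ofFun b := by rw [plus_add, hdiff.plus_eq, hneg, add_zero]

/-! ### Inverses of monic operators -/

variable {T : Subring R} {hT : ∀ a ∈ T, a′ ∈ T}

/-- The operators whose coefficients lie in a differential subring. -/
def opSubring (T : Subring R) (hT : ∀ a ∈ T, a′ ∈ T) : Subring (MicroDiff R) where
  carrier := {P | ∀ k, P.coeff k ∈ T}
  zero_mem' _ := T.zero_mem
  one_mem' k := by
    rw [coeff_one]
    split_ifs
    exacts [T.one_mem, T.zero_mem]
  add_mem' hP hQ k := T.add_mem (hP k) (hQ k)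
  neg_mem' hP k := T.neg_mem (hP k)
  mul_mem' {P Q} hP hQ k := by
    have iterDeriv_mem (r : ℕ) (a : R) (ha : a ∈ T) : iterDeriv R r a ∈ T := by
      induction r with
      | zero => exact ha
      | succ r ih => rw [iterDeriv_succ]; exact hT _ ih
    rw [coeff_mul]
    exact finsum_induction (· ∈ T) T.zero_mem (fun _ _ => T.add_mem)
      fun p => T.zsmul_mem (T.mul_mem (hP _) (iterDeriv_mem _ _ (hQ _))) _

theorem mem_opSubring {P : MicroDiff R} : P ∈ opSubring T hT ↔ ∀ k, P.coeff k ∈ T := Iff.rfl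

theorem monomial_mem_opSubring (l : ℤ) {a : R} (ha : a ∈ T) : monomial l a ∈ opSubring T hT :=
  fun k => by
    rw [coeff_monomial]
    split_ifs
    exacts [ha, T.zero_mem]

theorem ofFun_mem_opSubring {a : R} (ha : a ∈ T) : ofFun a ∈ opSubring T hT :=
  monomial_mem_opSubring 0 ha

theorem exists_forall_sub_mem_orderLE (F : ℕ → MicroDiff R)
    (hF : ∀ n : ℕ, F (n + 1) - F n ∈ orderLE R (-n)) :
    ∃ P : MicroDiff R, (∀ n : ℕ, P - F n ∈ orderLE R (-n)) ∧
      ((∀ n, F n ∈ opSubring T hT) → P ∈ opSubring T hT) := by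
  have hcauchy (n m : ℕ) (hnm : n ≤ m) : F m - F n ∈ orderLE R (-n) := by
    induction m, hnm using Nat.le_induction with
    | base => rw [sub_self]; exact zero_mem _
    | succ m hm ih =>
      rw [← sub_add_sub_cancel]
      exact add_mem (orderLE_mono (by omega) (hF m)) ih
  have hstable (k : ℤ) (n m : ℕ) (hn : -(n : ℤ) < k) (hm : -(m : ℤ) < k) :
      (F n).coeff k = (F m).coeff k := by
    rcases le_total n m with h | h
    · exact (sub_eq_zero.1 (mem_orderLE.1 (hcauchy n m h) k hn)).symm
    · exact sub_eq_zero.1 (mem_orderLE.1 (hcauchy m n h) k hm)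
  obtain ⟨N, hN⟩ := (F 0).exists_mem_orderLE
  refine ⟨⟨fun k => (F (k.natAbs + 1)).coeff k, max N 0, fun k hk => ?_⟩,
    fun n => mem_orderLE.2 fun k hk => ?_, fun h k => h _ _⟩
  · exact (hstable k _ 0 (by omega) (by simp; omega)).trans (mem_orderLE.1 hN k (by omega))
  · exact sub_eq_zero.2 (hstable k (k.natAbs + 1) n (by omega) hk)

theorem exists_inv_one_sub {X : MicroDiff R} (hX : X ∈ orderLE R (-1))
    (hXT : X ∈ opSubring T hT) :
    ∃ G ∈ opSubring T hT, (1 - X) * G = 1 ∧ G * (1 - X) = 1 ∧ G - 1 ∈ orderLE R (-1) := by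
  have hXn (n : ℕ) : X ^ n ∈ orderLE R (-n) := orderLE_mono (by omega) (pow_mem_orderLE hX n)
  have h1X : 1 - X ∈ orderLE R 0 := sub_mem one_mem_orderLE (orderLE_mono (by omega) hX)
  obtain ⟨G, hG, hGT⟩ := exists_forall_sub_mem_orderLE (T := T) (hT := hT)
    (fun n => ∑ i ∈ range n, X ^ i) fun n => by
      rw [sum_range_succ, add_sub_cancel_left]
      exact hXn n
  refine ⟨G, hGT fun n => sum_mem fun i _ => pow_mem hXT i, ?_, ?_, by simpa using hG 1⟩ <;>
    refine sub_eq_zero.1 (eq_zero_of_forall_mem_orderLE fun n => ?_)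
  · have hsplit : (1 - X) * G - 1 = (1 - X) * (G - ∑ i ∈ range n, X ^ i) - X ^ n := by
      rw [mul_sub (1 - X) G, mul_neg_geom_sum]
      abel
    rw [hsplit]
    exact sub_mem (by simpa using mul_mem_orderLE h1X (hG n)) (hXn n)
  · have hsplit : G * (1 - X) - 1 = (G - ∑ i ∈ range n, X ^ i) * (1 - X) - X ^ n := by
      rw [sub_mul G, geom_sum_mul_neg]
      abel
    rw [hsplit]
    exact sub_mem (by simpa using mul_mem_orderLE (hG n) h1X) (hXn n)

theorem monomial_one_mul_monomial_one (l m : ℤ) :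
    monomial l (1 : R) * monomial m 1 = monomial (l + m) 1 := by
  ext k
  by_cases hk : l + m < k
  · rw [mem_orderLE.1 (mul_mem_orderLE (monomial_mem_orderLE l 1) (monomial_mem_orderLE m 1)) k hk,
      mem_orderLE.1 (monomial_mem_orderLE (l + m) 1) k hk]
  obtain ⟨q, rfl⟩ : ∃ q : ℕ, k = l + m - q := ⟨(l + m - k).toNat, by omega⟩
  rw [coeff_monomial_mul_monomial, coeff_monomial]
  rcases eq_or_ne q 0 with rfl | hq
  · simp
  · rw [iterDeriv_eq_zero hq (Derivation.map_one_eq_zero _), mul_zero, smul_zero,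
      if_neg (by omega)]

theorem IsMonic.exists_inv {P : MicroDiff R} {N : ℤ} (hP : P.IsMonic N)
    (hPT : P ∈ opSubring T hT) :
    ∃ Q ∈ opSubring T hT, P * Q = 1 ∧ Q * P = 1 ∧ Q.IsMonic (-N) := by
  have hE : monomial N (1 : R) * monomial (-N) 1 = 1 := by
    rw [monomial_one_mul_monomial_one, add_neg_cancel]
    rfl
  have hET : monomial (-N) (1 : R) ∈ opSubring T hT := monomial_mem_opSubring _ T.one_mem
  have hEP : (monomial (-N) 1 * P).IsMonic 0 := by simpa using (isMonic_monomial (-N)).mul hP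
  obtain ⟨G, hGT, hmul, hmul', hG1⟩ := exists_inv_one_sub
    (isMonic_one.sub_mem_orderLE hEP) (sub_mem (one_mem (opSubring T hT)) (mul_mem hET hPT))
  rw [sub_sub_cancel] at hmul hmul'
  have hG : G.IsMonic 0 := by simpa using isMonic_one.add hG1 (by omega)
  refine ⟨G * monomial (-N) 1, mul_mem hGT hET, ?_, by rw [mul_assoc, hmul'],
    by simpa using hG.mul (isMonic_monomial (-N))⟩
  calc P * (G * monomial (-N) 1)
      = monomial N 1 * monomial (-N) 1 * P * (G * monomial (-N) 1) := by rw [hE, one_mul]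
    _ = monomial N 1 * (monomial (-N) 1 * P * G) * monomial (-N) 1 := by simp only [mul_assoc]
    _ = 1 := by rw [hmul, mul_one, hE]

theorem IsMonic.isUnit {P : MicroDiff R} {N : ℤ} (hP : P.IsMonic N) : IsUnit P := by
  obtain ⟨Q, -, hPQ, hQP, -⟩ :=
    hP.exists_inv (T := ⊤) (hT := fun _ _ => Subring.mem_top _) fun _ => Subring.mem_top _
  exact ⟨⟨P, Q, hPQ, hQP⟩, rfl⟩

theorem isMonic_inv {u : (MicroDiff R)ˣ} {N : ℤ} (hu : u.val.IsMonic N) :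
    (u⁻¹).val.IsMonic (-N) := by
  obtain ⟨Q, -, huQ, -, hQ⟩ :=
    hu.exists_inv (T := ⊤) (hT := fun _ _ => Subring.mem_top _) fun _ => Subring.mem_top _
  rwa [Units.inv_eq_of_mul_eq_one_right huQ]

theorem inv_mem_opSubring {u : (MicroDiff R)ˣ} {N : ℤ} (hu : u.val.IsMonic N)
    (huT : u.val ∈ opSubring T hT) : (u⁻¹).val ∈ opSubring T hT := by
  obtain ⟨Q, hQT, huQ, -, -⟩ := hu.exists_inv huT
  rwa [Units.inv_eq_of_mul_eq_one_right huQ]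

theorem isMonic_zpow {u : (MicroDiff R)ˣ} (hu : u.val.IsMonic 1) (k : ℤ) :
    (u ^ k).val.IsMonic k := by
  induction k with
  | zero => simpa using isMonic_one
  | succ k ih => rw [zpow_add_one, Units.val_mul]; exact ih.mul hu
  | pred k ih => rw [zpow_sub_one, Units.val_mul]; exact ih.mul (isMonic_inv hu)

theorem zpow_mem_opSubring {u : (MicroDiff R)ˣ} (hu : u.val.IsMonic 1)
    (huT : u.val ∈ opSubring T hT) (k : ℤ) : (u ^ k).val ∈ opSubring T hT := by
  induction k with
  | zero => simp
  | succ k ih => rw [zpow_add_one, Units.val_mul]; exact mul_mem ih huT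
  | pred k ih => rw [zpow_sub_one, Units.val_mul]; exact mul_mem ih (inv_mem_opSubring hu huT)

/-! ### Derivations, expansions and roots -/

theorem mem_orderLE_and_coeff_of_succ_eq {X Y E : MicroDiff R} (hX : X.IsMonic 1)
    (hY : Y.IsMonic 1) {d : ℤ} (hE : E ∈ orderLE R d) {F : ℕ → MicroDiff R} (hF : F 0 = 0)
    (hsucc : ∀ n, F (n + 1) = F n * X + Y ^ n * E) (n : ℕ) :
    F n ∈ orderLE R (d + n - 1) ∧ (F n).coeff (d + n - 1) = n * E.coeff d := by
  induction n with
  | zero => simp [hF, zero_mem]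
  | succ n ih =>
    obtain ⟨hord, hcoeff⟩ := ih
    rw [hsucc, show d + ((n + 1 : ℕ) : ℤ) - 1 = (d + n - 1) + 1 by push_cast; ring]
    have hYn := (hY.pow n).mem_orderLE
    have hshift : d + n - 1 + 1 = n + d := by ring
    refine ⟨add_mem (mul_mem_orderLE hord hX.mem_orderLE)
      (orderLE_mono hshift.ge (mul_mem_orderLE hYn hE)), ?_⟩
    rw [coeff_add, coeff_mul_top hord hX.mem_orderLE, hshift, coeff_mul_top hYn hE, hX.1,
      (hY.pow n).1, hcoeff]
    push_cast
    ring

section Derivation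

variable {D : MicroDiff R →+ MicroDiff R} (hD : ∀ P Q, D (P * Q) = D P * Q + P * D Q)
include hD

theorem mem_orderLE_of_derivation_pow [IsAddTorsionFree R] {X : MicroDiff R} (hX : X.IsMonic 1)
    {e : ℤ} {n : ℕ} (hn : n ≠ 0) (h : D (X ^ n) ∈ orderLE R (e + n - 1)) : D X ∈ orderLE R e := by
  refine mem_orderLE_of_forall_coeff_eq_zero fun d hed hd => ?_
  have htop := (mem_orderLE_and_coeff_of_succ_eq hX hX hd (F := fun n => D (X ^ n))
    (by simpa using hD 1 1) (fun n => by rw [pow_succ, hD]) n).2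
  rw [mem_orderLE.1 h _ (by omega), ← nsmul_eq_mul] at htop
  exact (nsmul_eq_zero_iff_right hn).1 htop.symm

theorem derivation_inv (u : (MicroDiff R)ˣ) :
    D (u⁻¹).val = -((u⁻¹).val * D u.val * (u⁻¹).val) := by
  have h : D (u⁻¹).val * u.val + (u⁻¹).val * D u.val = 0 := by
    rw [← hD, Units.inv_mul]
    simpa using hD 1 1
  have h' := congrArg (· * (u⁻¹).val) h
  simp only [zero_mul, add_mul, Units.mul_inv_cancel_right] at h'
  exact eq_neg_of_add_eq_zero_left h'

theorem derivation_zpow_mem_orderLE {u : (MicroDiff R)ˣ} (hu : u.val.IsMonic 1) {d : ℤ}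
    (hd : D u.val ∈ orderLE R d) (k : ℤ) : D (u ^ k).val ∈ orderLE R (d + k - 1) := by
  have hinv := (isMonic_inv hu).mem_orderLE
  induction k with
  | zero =>
    have h1 : D 1 = 0 := by simpa using hD 1 1
    rw [zpow_zero, Units.val_one, h1]
    exact zero_mem _
  | succ k ih =>
    rw [zpow_add_one, Units.val_mul, hD]
    exact add_mem (orderLE_mono (by omega) (mul_mem_orderLE ih hu.mem_orderLE))
      (orderLE_mono (by omega) (mul_mem_orderLE (isMonic_zpow hu k).mem_orderLE hd))
  | pred k ih =>
    rw [zpow_sub_one, Units.val_mul, hD, derivation_inv hD]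
    exact add_mem (orderLE_mono (by omega) (mul_mem_orderLE ih hinv))
      (orderLE_mono (by omega) (mul_mem_orderLE (isMonic_zpow hu _).mem_orderLE
        (neg_mem (mul_mem_orderLE (mul_mem_orderLE hinv hd) hinv))))

end Derivation

section Expansion

variable {Q : ℤ → MicroDiff R} (hQ : ∀ k, (Q k).IsMonic k)
include hQ

theorem eq_zero_of_sum_ofFun_mul_mem_orderLE {a : ℤ → R} {s : Finset ℤ} {d : ℤ}
    (h : ∑ k ∈ s, ofFun (a k) * Q k ∈ orderLE R d) : ∀ k ∈ s, d < k → a k = 0 := by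
  classical
  by_contra! ⟨k₀, hk₀, hdk₀, hne₀⟩
  obtain ⟨m, hm, hmax⟩ := exists_max_image (s.filter fun k => a k ≠ 0) id
    ⟨k₀, mem_filter.2 ⟨hk₀, hne₀⟩⟩
  obtain ⟨hms, ham⟩ := mem_filter.1 hm
  have hdm : d < m := hdk₀.trans_le (hmax k₀ (mem_filter.2 ⟨hk₀, hne₀⟩))
  have hcoeff := mem_orderLE.1 h m hdm
  rw [coeff_sum, sum_eq_single_of_mem m hms, coeff_ofFun_mul, (hQ m).1, mul_one] at hcoeff
  · exact ham hcoeff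
  · intro k hk hne
    rw [coeff_ofFun_mul]
    by_cases hak : a k = 0
    · rw [hak, zero_mul]
    · have hkm : k ≤ m := hmax k (mem_filter.2 ⟨hk, hak⟩)
      rw [mem_orderLE.1 (hQ k).mem_orderLE m (by omega), mul_zero]

theorem exists_expansion {𝒮 : AddSubgroup (MicroDiff R)} {V : AddSubgroup R} {d : ℤ}
    (hcoeff : ∀ P ∈ 𝒮, ∀ j, d < j → P ∈ orderLE R j → P.coeff j ∈ V)
    {N : ℤ} (hdN : d ≤ N) (hmul : ∀ c ∈ V, ∀ k ≤ N, ofFun c * Q k ∈ 𝒮) {P : MicroDiff R}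
    (hP𝒮 : P ∈ 𝒮) (hP : P ∈ orderLE R N) :
    ∃ a : ℤ → R, (∀ k, a k ∈ V) ∧ P - ∑ k ∈ Ioc d N, ofFun (a k) * Q k ∈ orderLE R d := by
  induction N, hdN using Int.leInduction generalizing P with
  | base => exact ⟨0, fun _ => zero_mem V, by simpa using hP⟩
  | succ N hdN ih =>
    set c := P.coeff (N + 1) with hc
    have hcV : c ∈ V := hcoeff P hP𝒮 _ (by omega) hP
    have hrem : P - ofFun c * Q (N + 1) ∈ orderLE R (N + 1 - 1) :=
      mem_orderLE_sub_one (sub_mem hP (ofFun_mul_mem_orderLE c (hQ _).mem_orderLE))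
        (by rw [coeff_sub, coeff_ofFun_mul, (hQ _).1, mul_one, ← hc, sub_self])
    rw [add_sub_cancel_right] at hrem
    obtain ⟨a, ha, had⟩ := ih (fun c hc k hk => hmul c hc k (by omega))
      (sub_mem hP𝒮 (hmul c hcV _ le_rfl)) hrem
    refine ⟨Function.update a (N + 1) c, fun k => ?_, ?_⟩
    · rcases eq_or_ne k (N + 1) with rfl | hk
      · rwa [Function.update_self]
      · rw [Function.update_of_ne hk]
        exact ha k
    · have hIoc : Ioc d (N + 1) = insert (N + 1) (Ioc d N) := by
        ext k
        simp only [mem_Ioc, mem_insert]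
        omega
      have hsum : ∑ k ∈ Ioc d N, ofFun (Function.update a (N + 1) c k) * Q k =
          ∑ k ∈ Ioc d N, ofFun (a k) * Q k :=
        sum_congr rfl fun k hk => by
          rw [mem_Ioc] at hk
          rw [Function.update_of_ne (by omega)]
      rwa [hIoc, sum_insert (by simp), hsum, Function.update_self, ← sub_sub]

end Expansion

theorem IsMonic.exists_approx_root {m : ℕ} (hdiv : ∀ a ∈ T, ∃ b ∈ T, (m : R) * b = a)
    {B : MicroDiff R} (hB : B.IsMonic m) (hBT : B ∈ opSubring T hT) (j : ℕ) :
    ∃ X ∈ opSubring T hT, X.IsMonic 1 ∧ X ^ m - B ∈ orderLE R (m - 1 - j) := by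
  induction j with
  | zero =>
    refine ⟨monomial 1 1, monomial_mem_opSubring 1 T.one_mem, isMonic_monomial 1, ?_⟩
    simpa using ((isMonic_monomial 1).pow m).sub_mem_orderLE hB
  | succ j ih =>
    obtain ⟨X, hXT, hX, hord⟩ := ih
    obtain ⟨b, hbT, hb⟩ := hdiv _ (sub_mem (pow_mem hXT m) hBT (m - 1 - j : ℤ))
    have hmono : -monomial (-j) b ∈ orderLE R (-j) := neg_mem (monomial_mem_orderLE _ b)
    have hY : (X + -monomial (-j) b).IsMonic 1 := hX.add hmono (by omega)
    obtain ⟨hdiff, htop⟩ := mem_orderLE_and_coeff_of_succ_eq hX hY hmono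
      (F := fun n => (X + -monomial (-j) b) ^ n - X ^ n) (by simp)
      (fun n => by rw [pow_succ, pow_succ]; noncomm_ring) m
    refine ⟨X + -monomial (-j) b, add_mem hXT (neg_mem (monomial_mem_opSubring _ hbT)), hY, ?_⟩
    rw [show (-j + m - 1 : ℤ) = m - 1 - j by ring] at hdiff htop
    rw [show (m : ℤ) - 1 - ((j + 1 : ℕ) : ℤ) = m - 1 - j - 1 by push_cast; ring,
      ← sub_add_sub_cancel _ (X ^ m) B]
    refine mem_orderLE_sub_one (add_mem hdiff hord) ?_
    rw [coeff_add, htop, coeff_neg, coeff_monomial, if_pos rfl, mul_neg, hb, neg_add_cancel]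

end Algebra

end MicroDiff

/-! ### Power series in several variables -/

section PowerSeries

open MvPowerSeries

variable {σ τ R K : Type*} [CommRing K]

variable (σ) in
/-- The power series whose coefficients all lie in `V`. -/
def coeffsIn [Semiring R] [Module R K] (V : Submodule R K) : Submodule R (MvPowerSeries σ K) where
  carrier := {f | ∀ α, coeff α f ∈ V}
  zero_mem' _ := zero_mem V
  add_mem' hf hg α := add_mem (hf α) (hg α)
  smul_mem' c _ hf α := V.smul_mem c (hf α)

/-- The ideal of the power series without monomials in the lower set `s` of exponents. -/
def vanishingOn (K : Type*) [CommRing K] (s : LowerSet (σ →₀ ℕ)) : Ideal (MvPowerSeries σ K) where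
  carrier := {f | ∀ α ∈ s, coeff α f = 0}
  zero_mem' _ _ := rfl
  add_mem' hf hg α hα := by rw [map_add, hf α hα, hg α hα, add_zero]
  smul_mem' f g hg α hα := by
    classical
    rw [smul_eq_mul, coeff_mul]
    refine sum_eq_zero fun p hp => ?_
    rw [hg p.2 (s.lower (HasAntidiagonal.mem_antidiagonal.1 hp ▸ le_add_self) hα), mul_zero]

theorem pderiv_mem_vanishingOn {s s' : LowerSet (σ →₀ ℕ)} {n : σ}
    (h : ∀ α ∈ s', α + Finsupp.single n 1 ∈ s) {f : MvPowerSeries σ K} (hf : f ∈ vanishingOn K s) :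
    pderiv K n f ∈ vanishingOn K s' := fun α hα => by
  rw [coeff_pderiv, hf _ (h α hα), zero_mul]

theorem coeff_pderiv_sub_single {γ : σ →₀ ℕ} {n : σ} (hn : γ n ≠ 0) (f : MvPowerSeries σ K) :
    coeff (γ - Finsupp.single n 1) (pderiv K n f) = γ n • coeff γ f := by
  have hle : Finsupp.single n 1 ≤ γ := Finsupp.single_le_iff.2 (Nat.one_le_iff_ne_zero.2 hn)
  have hγ : γ n = (γ - Finsupp.single n 1 : σ →₀ ℕ) n + 1 := by
    rw [Finsupp.tsub_apply, Finsupp.single_eq_same, Nat.sub_add_cancel (by omega)]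
  rw [coeff_pderiv, tsub_add_cancel_of_le hle, nsmul_eq_mul, mul_comm, hγ, Nat.cast_succ]

theorem nsmul_coeff_sub_single_of_closed {g : σ → MvPowerSeries σ K}
    (hg : ∀ m n, pderiv K m (g n) = pderiv K n (g m)) {γ : σ →₀ ℕ} {m n : σ} (hm : γ m ≠ 0)
    (hn : γ n ≠ 0) : γ n • coeff (γ - Finsupp.single m 1) (g m) =
      γ m • coeff (γ - Finsupp.single n 1) (g n) := by
  rcases eq_or_ne m n with rfl | hmn
  · rfl
  have h := congrArg (coeff (γ - Finsupp.single m 1 - Finsupp.single n 1)) (hg n m)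
  have hn' : (γ - Finsupp.single m 1 : σ →₀ ℕ) n = γ n := by simp [hmn]
  have hm' : (γ - Finsupp.single n 1 : σ →₀ ℕ) m = γ m := by simp [hmn.symm]
  rwa [coeff_pderiv_sub_single (by rwa [hn']), tsub_right_comm,
    coeff_pderiv_sub_single (by rwa [hm']), hn', hm'] at h

/-- The Poincaré lemma. The last conjunct records that the coefficients of the potential are
rational combinations of those of the closed form. -/
theorem exists_pderiv_eq [Module ℚ K] {g : σ → MvPowerSeries σ K}
    (hg : ∀ m n, pderiv K m (g n) = pderiv K n (g m)) :
    ∃ f : MvPowerSeries σ K, constantCoeff f = 0 ∧ (∀ n, pderiv K n f = g n) ∧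
      ∀ V : Submodule ℚ K, (∀ n, g n ∈ coeffsIn σ V) → f ∈ coeffsIn σ V := by
  let f : MvPowerSeries σ K := fun α =>
    (α.degree : ℚ)⁻¹ • ∑ n ∈ α.support, coeff (α - Finsupp.single n 1) (g n)
  have coeff_f (α) : coeff α f =
    (α.degree : ℚ)⁻¹ • ∑ n ∈ α.support, coeff (α - Finsupp.single n 1) (g n) := rfl
  refine ⟨f, ?_, fun n => ?_, fun V hV α => V.smul_mem _ (sum_mem fun n _ => hV n _)⟩
  · rw [← coeff_zero_eq_constantCoeff_apply, coeff_f, Finsupp.support_zero, sum_empty, smul_zero]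
  ext α
  set γ := α + Finsupp.single n 1 with hγ
  have hγn : γ n ≠ 0 := by simp [hγ]
  have hdeg : (γ.degree : ℚ) ≠ 0 := by
    rw [hγ, map_add, Finsupp.degree_single]
    positivity
  have hsum : γ n • ∑ m ∈ γ.support, coeff (γ - Finsupp.single m 1) (g m) =
      γ.degree • coeff (γ - Finsupp.single n 1) (g n) := by
    rw [smul_sum, Finsupp.degree_apply, sum_smul]
    exact sum_congr rfl fun m hm =>
      nsmul_coeff_sub_single_of_closed hg (Finsupp.mem_support_iff.1 hm) hγn
  rw [← add_tsub_cancel_right α (Finsupp.single n 1), ← hγ, coeff_pderiv_sub_single hγn, coeff_f,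
    smul_comm, hsum, ← Nat.cast_smul_eq_nsmul ℚ, inv_smul_smul₀ hdeg]

section ChainRule

variable {k : Type*} [CommRing k] {_ : Algebra k (MvPowerSeries τ K)}
  {D : Derivation k (MvPowerSeries τ K) (MvPowerSeries τ K)} [CommRing R] [Algebra R K]

theorem derivation_subst_coe (hDR : ∀ c : R, D (algebraMap R (MvPowerSeries τ K) c) = 0)
    {a : σ → MvPowerSeries τ K} (ha : HasSubst a) {s : Finset σ} (hs : ∀ n ∉ s, D (a n) = 0)
    (p : MvPolynomial σ R) :
    D (subst a (p : MvPowerSeries σ R)) =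
      ∑ n ∈ s, subst a (pderiv R n (p : MvPowerSeries σ R)) * D (a n) := by
  classical
  induction p using MvPolynomial.induction_on with
  | C c =>
    have h0 : subst a (0 : MvPowerSeries σ R) = 0 := by rw [← coe_substAlgHom ha, map_zero]
    simp only [MvPolynomial.coe_C, pderiv_C, h0, zero_mul, sum_const_zero]
    rw [← coe_substAlgHom ha, c_eq_algebraMap, AlgHom.commutes, hDR]
  | add p q hp hq =>
    simp only [MvPolynomial.coe_add, map_add, subst_add ha, hp, hq, add_mul, sum_add_distrib]
  | mul_X p k hp =>
    have hk : ∑ n ∈ s, subst a (pderiv R n (X k : MvPowerSeries σ R)) * D (a n) = D (a k) := by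
      have (n : σ) : subst a (pderiv R n (X k : MvPowerSeries σ R)) = if k = n then 1 else 0 := by
        rw [← coe_substAlgHom ha, pderiv_X, Pi.single_apply, apply_ite (substAlgHom ha), map_one,
          map_zero]
      simp only [this, ite_mul, one_mul, zero_mul, sum_ite_eq]
      split_ifs with hks
      · rfl
      · exact (hs k hks).symm
    simp only [MvPolynomial.coe_mul, MvPolynomial.coe_X, Derivation.leibniz, smul_eq_mul,
      subst_add ha, subst_mul ha, subst_X ha, add_mul, sum_add_distrib, mul_assoc, ← mul_sum, hk,
      hp]

open scoped MvPowerSeries.WithPiTopology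

theorem continuous_pderiv [TopologicalSpace K] [ContinuousMul K] (n : σ) :
    Continuous (pderiv K n) :=
  continuous_pi fun α => (continuous_congr fun f => coeff_pderiv f α).2 <|
    (WithPiTopology.continuous_coeff K (α + Finsupp.single n 1)).mul_const ((α n : K) + 1)

theorem derivation_subst [UniformSpace K] [DiscreteUniformity K] (hD : Continuous D)
    (hDR : ∀ c : R, D (algebraMap R (MvPowerSeries τ K) c) = 0)
    {a : σ → MvPowerSeries τ K} (ha : HasSubst a) {s : Finset σ} (hs : ∀ n ∉ s, D (a n) = 0)
    (f : MvPowerSeries σ R) : D (subst a f) = ∑ n ∈ s, subst a (pderiv R n f) * D (a n) := by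
  let _ : UniformSpace R := ⊥
  refine congrFun (WithPiTopology.denseRange_toMvPowerSeries.equalizer
    (hD.comp (continuous_subst ha)) (continuous_finsetSum s fun n _ =>
      ((continuous_subst ha).comp (continuous_pderiv n)).mul_const (D (a n)))
    (funext fun p => derivation_subst_coe hDR ha hs p)) f

end ChainRule

end PowerSeries

/-! ### Functions of `x` and the times -/

section Functions

open MvPowerSeries (constantCoeff)

variable {A : Type*} [CommRing A]

theorem coeff_coeff_xDeriv (f : Fun A) (α : ℕ+ →₀ ℕ) (n : ℤ) :
    (MvPowerSeries.coeff α (xDeriv A f)).coeff n =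
      (n + 1) • (MvPowerSeries.coeff α f).coeff (n + 1) := by
  change (LaurentSeries.derivative ℤ (MvPowerSeries.coeff α f)).coeff n = _
  rw [LaurentSeries.derivative_apply, LaurentSeries.hasseDeriv_coeff]
  simp only [Nat.cast_one, Ring.choose_one_right]

theorem tDeriv_xDeriv (n : ℕ+) (f : Fun A) : tDeriv n (xDeriv A f) = xDeriv A (tDeriv n f) := by
  ext α k
  have coeff_tDeriv (g : Fun A) (β : ℕ+ →₀ ℕ) : MvPowerSeries.coeff β (tDeriv n g) =
      (β n + 1) • MvPowerSeries.coeff (β + Finsupp.single n 1) g := by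
    rw [tDeriv, MvPowerSeries.coeff_pderiv, nsmul_eq_mul, mul_comm, Nat.cast_succ]
  rw [coeff_tDeriv, HahnSeries.coeff_smul, coeff_coeff_xDeriv, coeff_coeff_xDeriv, coeff_tDeriv,
    HahnSeries.coeff_smul, smul_comm]

theorem tDeriv_mul (n : ℕ+) (f g : Fun A) : tDeriv n (f * g) = tDeriv n f * g + f * tDeriv n g := by
  rw [Derivation.leibniz, smul_eq_mul, smul_eq_mul, mul_comm g, add_comm]

theorem tDeriv_ofTimes (n : ℕ+) (g : MvPowerSeries ℕ+ A) :
    tDeriv n (ofTimes g) = ofTimes (MvPowerSeries.pderiv A n g) := by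
  ext1 α
  rw [tDeriv, MvPowerSeries.coeff_pderiv, ofTimes, MvPowerSeries.coeff_map,
    MvPowerSeries.coeff_map, MvPowerSeries.coeff_pderiv, map_mul, map_add, map_natCast, map_one]

theorem coeff_coeff_ofTimes (g : MvPowerSeries ℕ+ A) (α : ℕ+ →₀ ℕ) (n : ℤ) :
    (MvPowerSeries.coeff α (ofTimes g)).coeff n =
      if n = 0 then MvPowerSeries.coeff α g else 0 := by
  rw [ofTimes, MvPowerSeries.coeff_map, HahnSeries.C_apply, HahnSeries.coeff_single]
  congr

theorem ofTimes_injective : Function.Injective (ofTimes (A := A)) :=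
  fun f g h => by
    ext α
    simpa only [coeff_coeff_ofTimes, if_true] using
      congrArg (fun u : Fun A => (MvPowerSeries.coeff α u).coeff 0) h

theorem xDeriv_ofTimes (g : MvPowerSeries ℕ+ A) : xDeriv A (ofTimes g) = 0 := by
  ext α n
  rw [coeff_coeff_xDeriv, coeff_coeff_ofTimes]
  split_ifs with h
  · rw [h, zero_smul]; rfl
  · rw [smul_zero]; rfl

/-- The coefficient of `x^n`, a series in the times. -/
def xCoeff (n : ℤ) (f : Fun A) : MvPowerSeries ℕ+ A := fun α => (MvPowerSeries.coeff α f).coeff n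

theorem coeff_xCoeff (n : ℤ) (f : Fun A) (α : ℕ+ →₀ ℕ) :
    MvPowerSeries.coeff α (xCoeff n f) = (MvPowerSeries.coeff α f).coeff n := rfl

theorem eq_ofTimes_xCoeff_zero [IsAddTorsionFree A] {f : Fun A} (hf : xDeriv A f = 0) :
    f = ofTimes (xCoeff 0 f) := by
  ext α n
  rw [coeff_coeff_ofTimes]
  split_ifs with h
  · rw [h, coeff_xCoeff]
  · have h1 : n • (MvPowerSeries.coeff α f).coeff n = 0 := by
      have := coeff_coeff_xDeriv f α (n - 1)
      rw [hf, sub_add_cancel] at this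
      exact this.symm
    exact (smul_eq_zero.1 h1).resolve_left h

variable (A) in
/-- The Laurent series with a pole of order at most `N`. -/
def poleLE (N : ℕ) : Submodule A (LaurentSeries A) where
  carrier := {g | ∀ n < -(N : ℤ), g.coeff n = 0}
  zero_mem' _ _ := rfl
  add_mem' hf hg n hn := by rw [HahnSeries.coeff_add, hf n hn, hg n hn, add_zero]
  smul_mem' c _ hf n hn := by rw [HahnSeries.coeff_smul, hf n hn, smul_zero]

theorem poleLE_mono {N M : ℕ} (h : N ≤ M) : poleLE A N ≤ poleLE A M :=
  fun _ hf n hn => hf n (by omega)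

theorem mul_mem_poleLE {N M : ℕ} {f g : LaurentSeries A} (hf : f ∈ poleLE A N)
    (hg : g ∈ poleLE A M) : f * g ∈ poleLE A (N + M) := fun n hn => by
  rw [laurent_coeff_mul f g _ _ n hf hg, Icc_eq_empty (by push_cast at hn; omega), sum_empty]

theorem C_mem_poleLE (N : ℕ) (a : A) : HahnSeries.C a ∈ poleLE A N := fun n hn => by
  rw [HahnSeries.C_apply, HahnSeries.coeff_single_of_ne (by omega)]

theorem derivative_mem_poleLE {N : ℕ} {f : LaurentSeries A} (hf : f ∈ poleLE A N) :
    LaurentSeries.derivative ℤ f ∈ poleLE A (N + N) := fun n hn => by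
  rw [LaurentSeries.derivative_apply, LaurentSeries.hasseDeriv_coeff]
  rcases eq_or_ne (n + 1) 0 with h | h
  · simp [h]
  · rw [hf _ (by push_cast at hn ⊢; omega), smul_zero]

theorem mul_mem_coeffsIn_poleLE {N M : ℕ} {f g : Fun A} (hf : f ∈ coeffsIn ℕ+ (poleLE A N))
    (hg : g ∈ coeffsIn ℕ+ (poleLE A M)) : f * g ∈ coeffsIn ℕ+ (poleLE A (N + M)) := fun α => by
  classical
  rw [MvPowerSeries.coeff_mul]
  exact sum_mem fun p _ => mul_mem_poleLE (hf p.1) (hg p.2)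

theorem ofTimes_mem_coeffsIn_poleLE (N : ℕ) (g : MvPowerSeries ℕ+ A) :
    ofTimes g ∈ coeffsIn ℕ+ (poleLE A N) := fun α => by
  rw [ofTimes, MvPowerSeries.coeff_map]
  exact C_mem_poleLE N _

variable (A) in
/-- The functions whose order of pole in `x` is bounded by an element of `I`. The two cases of
interest are `I = ⊥`, which is `powerFun A`, and `I = ⊤`, which is `laurentFun A`. -/
def bddSubring (I : AddSubmonoid ℕ) : Subring (Fun A) where
  carrier := {f | ∃ N ∈ I, f ∈ coeffsIn ℕ+ (poleLE A N)}
  zero_mem' := ⟨0, I.zero_mem, zero_mem _⟩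
  one_mem' := ⟨0, I.zero_mem, map_one (ofTimes (A := A)) ▸ ofTimes_mem_coeffsIn_poleLE 0 1⟩
  add_mem' := by
    rintro f g ⟨N, hN, hf⟩ ⟨M, hM, hg⟩
    exact ⟨N + M, I.add_mem hN hM, fun α =>
      add_mem (poleLE_mono (by omega) (hf α)) (poleLE_mono (by omega) (hg α))⟩
  neg_mem' := by
    rintro f ⟨N, hN, hf⟩
    exact ⟨N, hN, neg_mem hf⟩
  mul_mem' := by
    rintro f g ⟨N, hN, hf⟩ ⟨M, hM, hg⟩
    exact ⟨N + M, I.add_mem hN hM, mul_mem_coeffsIn_poleLE hf hg⟩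

variable {I : AddSubmonoid ℕ}

theorem mem_bddSubring {f : Fun A} :
    f ∈ bddSubring A I ↔ ∃ N ∈ I, f ∈ coeffsIn ℕ+ (poleLE A N) := Iff.rfl

theorem deriv_mem_bddSubring (f : Fun A) (hf : f ∈ bddSubring A I) : f′ ∈ bddSubring A I := by
  obtain ⟨N, hN, hf⟩ := hf
  exact ⟨N + N, I.add_mem hN hN, fun α => derivative_mem_poleLE (hf α)⟩

theorem ofTimes_mem_bddSubring (g : MvPowerSeries ℕ+ A) : ofTimes g ∈ bddSubring A I :=
  ⟨0, I.zero_mem, ofTimes_mem_coeffsIn_poleLE 0 g⟩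

theorem exists_natCast_mul_eq [Algebra ℚ A] {m : ℕ} (hm : m ≠ 0) (f : Fun A)
    (hf : f ∈ bddSubring A I) : ∃ g ∈ bddSubring A I, (m : Fun A) * g = f := by
  refine ⟨ofTimes (algebraMap ℚ _ (m : ℚ)⁻¹) * f, mul_mem (ofTimes_mem_bddSubring _) hf, ?_⟩
  have hm' : (m : ℚ) ≠ 0 := Nat.cast_ne_zero.2 hm
  rw [← mul_assoc, ← map_natCast (ofTimes.comp (algebraMap ℚ (MvPowerSeries ℕ+ A))),
    RingHom.comp_apply, ← map_mul, ← map_mul, mul_inv_cancel₀ hm', map_one, map_one, one_mul]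

variable (A) in
theorem powerFun_eq : powerFun A = bddSubring A ⊥ := by
  ext f
  simp only [SetLike.mem_coe, mem_bddSubring, AddSubmonoid.mem_bot, exists_eq_left]
  have coeff_of_neg (g : PowerSeries (MvPowerSeries ℕ+ A)) (n : ℤ) (hn : n < 0) :
      (HahnSeries.ofPowerSeries ℤ _ g).coeff n = 0 := by
    rw [HahnSeries.ofPowerSeries_apply]
    refine HahnSeries.embDomain_of_notMem_range ?_
    rintro ⟨m, rfl⟩
    exact hn.not_ge (Int.natCast_nonneg m)
  constructor
  · rintro ⟨g, hg⟩ α n hn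
    rw [hg, coeff_of_neg g n (by simpa using hn), map_zero]
  · intro h
    refine ⟨PowerSeries.mk fun n => xCoeff n f, fun α n => ?_⟩
    by_cases hn : n < 0
    · rw [coeff_of_neg _ n hn, map_zero, h α n (by simpa using hn)]
    · obtain ⟨m, rfl⟩ := Int.eq_ofNat_of_zero_le (not_lt.1 hn)
      rw [HahnSeries.ofPowerSeries_apply_coeff, PowerSeries.coeff_mk, coeff_xCoeff]

variable (A) in
theorem laurentFun_eq : laurentFun A = bddSubring A ⊤ := by
  ext f
  simp only [SetLike.mem_coe, mem_bddSubring, AddSubmonoid.mem_top, true_and]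
  constructor
  · rintro ⟨g, hg⟩
    refine ⟨g.order.natAbs, fun α n hn => ?_⟩
    rw [hg, HahnSeries.coeff_eq_zero_of_lt_order (by omega), map_zero]
  · rintro ⟨N, h⟩
    refine ⟨HahnSeries.ofSuppBddBelow (fun n => xCoeff n f) ⟨-N, fun n hn => ?_⟩, fun α n => rfl⟩
    by_contra hlt
    exact hn (funext fun α => h α n (not_le.1 hlt))

end Functions

section OpDeriv

namespace MicroDiff

variable {R : Type*} [CommRing R]

/-- `MicroDiff.map` as an additive map. -/
def mapHom (φ : R →+ R) : MicroDiff R →+ MicroDiff R where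
  toFun := map φ
  map_zero' := by ext; exact map_zero φ
  map_add' P Q := by ext; exact map_add φ _ _

theorem map_mul_of_derivation [Differential R] {φ : R →+ R}
    (hmul : ∀ a b, φ (a * b) = φ a * b + a * φ b) (hcomm : ∀ a, φ a′ = (φ a)′)
    (P Q : MicroDiff R) : map φ (P * Q) = map φ P * Q + P * map φ Q := by
  have map_iterDeriv (r : ℕ) (a : R) : φ (iterDeriv R r a) = iterDeriv R r (φ a) := by
    induction r with
    | zero => rfl
    | succ r ih => rw [iterDeriv_succ, iterDeriv_succ, hcomm, ih]
  ext k
  rw [coeff_add, coeff_map, coeff_mul, coeff_mul, coeff_mul,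
    ← finsum_add_distrib (finite_support_coeff_mul _ _ k) (finite_support_coeff_mul _ _ k),
    map_finsum φ (finite_support_coeff_mul P Q k)]
  refine finsum_congr fun p => ?_
  rw [map_zsmul, hmul, map_iterDeriv, smul_add]
  rfl

end MicroDiff

open MicroDiff

variable {A : Type*} [CommRing A]

/-- `opDeriv n` as an additive map. -/
def opDerivHom (n : ℕ+) : MicroDiff (Fun A) →+ MicroDiff (Fun A) :=
  mapHom (tDeriv n).toLinearMap.toAddMonoidHom

theorem coeff_opDeriv (n : ℕ+) (P : MicroDiff (Fun A)) (k : ℤ) :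
    (opDeriv n P).coeff k = tDeriv n (P.coeff k) := rfl

theorem opDeriv_mul (n : ℕ+) (P Q : MicroDiff (Fun A)) :
    opDeriv n (P * Q) = opDeriv n P * Q + P * opDeriv n Q :=
  map_mul_of_derivation (tDeriv_mul n) (tDeriv_xDeriv n) P Q

theorem opDeriv_ofFun (n : ℕ+) (c : Fun A) : opDeriv n (ofFun c) = ofFun (tDeriv n c) := by
  ext1 k
  rw [coeff_opDeriv, coeff_ofFun, coeff_ofFun, apply_ite (tDeriv n), map_zero]

theorem opDeriv_mem_orderLE (n : ℕ+) {P : MicroDiff (Fun A)} {N : ℤ} (hP : P ∈ orderLE (Fun A) N) :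
    opDeriv n P ∈ orderLE (Fun A) N :=
  mem_orderLE.2 fun k hk => by rw [coeff_opDeriv, mem_orderLE.1 hP k hk, map_zero]

theorem MicroDiff.IsMonic.opDeriv_mem_orderLE (n : ℕ+) {P : MicroDiff (Fun A)} {N : ℤ}
    (hP : P.IsMonic N) :
    opDeriv n P ∈ orderLE (Fun A) (N - 1) :=
  mem_orderLE_sub_one (KP.opDeriv_mem_orderLE n hP.mem_orderLE)
    (by rw [coeff_opDeriv, hP.1, Derivation.map_one_eq_zero])

end OpDeriv

/-! ### Exponentials -/

section Exponential

section SubstExp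

variable {σ R K : Type*} [CommRing R] [Algebra ℚ R] [CommRing K] [Algebra R K]
  {f : MvPowerSeries σ K}

theorem subst_exp_mul_subst_neg_exp (hf : PowerSeries.HasSubst f) :
    PowerSeries.subst f (PowerSeries.exp R) * PowerSeries.subst (-f) (PowerSeries.exp R) = 1 := by
  have h : PowerSeries.subst (-f) (PowerSeries.exp R) =
      PowerSeries.subst f (PowerSeries.evalNegHom (PowerSeries.exp R)) := by
    have hX : PowerSeries.HasSubst ((-1 : R) • (PowerSeries.X : PowerSeries R)) := by
      rw [neg_one_smul]
      exact PowerSeries.HasSubst.of_constantCoeff_zero' (by simp)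
    rw [PowerSeries.evalNegHom, PowerSeries.rescale_eq_subst,
      PowerSeries.subst_comp_subst_apply hX hf, PowerSeries.subst_smul hf, PowerSeries.subst_X hf,
      neg_one_smul]
  rw [h, ← PowerSeries.subst_mul hf, PowerSeries.exp_mul_exp_neg_eq_one,
    ← PowerSeries.coe_substAlgHom hf, map_one]

open scoped MvPowerSeries.WithPiTopology

theorem derivation_subst_exp {k : Type*} [CommRing k] {_ : Algebra k (MvPowerSeries σ K)}
    {D : Derivation k (MvPowerSeries σ K) (MvPowerSeries σ K)} [UniformSpace K]
    [DiscreteUniformity K] (hD : Continuous D)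
    (hDR : ∀ c : R, D (algebraMap R (MvPowerSeries σ K) c) = 0) (hf : PowerSeries.HasSubst f) :
    D (PowerSeries.subst f (PowerSeries.exp R)) =
      D f * PowerSeries.subst f (PowerSeries.exp R) := by
  have pderiv_exp : MvPowerSeries.pderiv R () (PowerSeries.exp R) = PowerSeries.exp R :=
    PowerSeries.derivative_exp R
  rw [PowerSeries.subst, derivation_subst hD hDR (PowerSeries.HasSubst.const hf) (s := univ)
    (fun n hn => absurd (mem_univ n) hn), univ_unique, sum_singleton, pderiv_exp, mul_comm]

end SubstExp

variable {A : Type*} [CommRing A] [Algebra ℂ A] {f : Fun A}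

open MvPowerSeries (constantCoeff)

open MicroDiff

open scoped MvPowerSeries.WithPiTopology

theorem algebraMap_eq_ofTimes (c : ℂ) :
    algebraMap ℂ (Fun A) c = ofTimes (algebraMap ℂ (MvPowerSeries ℕ+ A) c) := by
  rw [MvPowerSeries.algebraMap_apply, MvPowerSeries.algebraMap_apply, ofTimes,
    MvPowerSeries.map_C, HahnSeries.algebraMap_apply', MvPowerSeries.algebraMap_apply]
  exact congrArg _ (HahnSeries.ofPowerSeries_C _)

theorem deriv_mul {A : Type*} [CommRing A] (f g : Fun A) : (f * g)′ = f * g′ + g * f′ :=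
  xDeriv_mul f g

theorem deriv_expFun (hf : constantCoeff f = 0) : (expFun f)′ = f′ * expFun f := by
  let _ : UniformSpace (LaurentSeries A) := ⊥
  have hD : Continuous (xDeriv A) := continuous_pi fun α =>
    (continuous_of_discreteTopology (f := LaurentSeries.derivative ℤ)).comp
      (MvPowerSeries.WithPiTopology.continuous_coeff (LaurentSeries A) α)
  refine derivation_subst_exp (R := ℂ) (D := Differential.deriv) hD (fun c => ?_)
    (.of_constantCoeff_zero hf)
  rw [algebraMap_eq_ofTimes]
  exact xDeriv_ofTimes _

theorem tDeriv_expFun (n : ℕ+) (hf : constantCoeff f = 0) :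
    tDeriv n (expFun f) = tDeriv n f * expFun f := by
  let _ : UniformSpace (LaurentSeries A) := ⊥
  refine derivation_subst_exp (R := ℂ) (D := tDeriv n) (continuous_pderiv n) (fun c => ?_)
    (.of_constantCoeff_zero hf)
  rw [MvPowerSeries.algebraMap_apply]
  exact MvPowerSeries.pderiv_C

theorem expFun_mul_expFun_neg (hf : constantCoeff f = 0) : expFun f * expFun (-f) = 1 :=
  subst_exp_mul_subst_neg_exp (.of_constantCoeff_zero hf)

variable {I : AddSubmonoid ℕ}

theorem expFun_neg_mul_iterDeriv_mem (hf : constantCoeff f = 0) (hfI : f ∈ bddSubring A I)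
    (r : ℕ) : expFun (-f) * iterDeriv (Fun A) r (expFun f) ∈ bddSubring A I := by
  induction r with
  | zero =>
    rw [iterDeriv_zero, mul_comm, expFun_mul_expFun_neg hf]
    exact one_mem _
  | succ r ih =>
    have hneg : constantCoeff (-f) = 0 := by rw [map_neg, hf, neg_zero]
    have hrec : expFun (-f) * iterDeriv (Fun A) (r + 1) (expFun f) =
        (expFun (-f) * iterDeriv (Fun A) r (expFun f))′ +
          f′ * (expFun (-f) * iterDeriv (Fun A) r (expFun f)) := by
      rw [iterDeriv_succ, deriv_mul, deriv_expFun hneg, map_neg]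
      ring
    rw [hrec]
    exact add_mem (deriv_mem_bddSubring _ ih) (mul_mem (deriv_mem_bddSubring _ hfI) ih)

theorem ofFun_expFun_mul_ofFun_expFun_neg (hf : constantCoeff f = 0) :
    ofFun (expFun f) * ofFun (expFun (-f)) = 1 := by
  rw [← ofFun_mul, expFun_mul_expFun_neg hf, ofFun_one]

theorem ofFun_expFun_neg_mul_ofFun_expFun (hf : constantCoeff f = 0) :
    ofFun (expFun (-f)) * ofFun (expFun f) = 1 := by
  rw [← ofFun_mul, mul_comm, expFun_mul_expFun_neg hf, ofFun_one]

/-- The gauge transformation `P ↦ e^{-f} P e^f`. -/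
def gauge (f : Fun A) (hf : constantCoeff f = 0) : MicroDiff (Fun A) →+* MicroDiff (Fun A) where
  toFun P := ofFun (expFun (-f)) * P * ofFun (expFun f)
  map_zero' := by rw [mul_zero, zero_mul]
  map_one' := by rw [mul_one, ofFun_expFun_neg_mul_ofFun_expFun hf]
  map_add' P Q := by rw [mul_add, add_mul]
  map_mul' P Q := by
    simp only [mul_assoc]
    rw [← mul_assoc (ofFun (expFun f)), ofFun_expFun_mul_ofFun_expFun_neg hf, one_mul]

theorem gauge_apply (hf : constantCoeff f = 0) (P : MicroDiff (Fun A)) :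
    gauge f hf P = ofFun (expFun (-f)) * P * ofFun (expFun f) := rfl

theorem gauge_mem_opSubring (hf : constantCoeff f = 0) (hfI : f ∈ bddSubring A I)
    {P : MicroDiff (Fun A)} (hP : P ∈ opSubring (bddSubring A I) deriv_mem_bddSubring) :
    gauge f hf P ∈ opSubring (bddSubring A I) deriv_mem_bddSubring := fun k => by
  rw [gauge_apply, mul_assoc, coeff_ofFun_mul, coeff_mul, ← AddMonoidHom.coe_mulLeft,
    map_finsum _ (finite_support_coeff_mul _ _ k)]
  refine finsum_induction (· ∈ bddSubring A I) (zero_mem _) (fun _ _ => add_mem) fun p => ?_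
  rw [AddMonoidHom.coe_mulLeft, mul_smul_comm, mul_left_comm, coeff_ofFun]
  refine zsmul_mem (mul_mem (hP _) ?_) _
  split_ifs
  · exact expFun_neg_mul_iterDeriv_mem hf hfI _
  · rw [map_zero, mul_zero]
    exact zero_mem _

theorem gauge_ofFun (hf : constantCoeff f = 0) (g : Fun A) :
    gauge f hf (ofFun g) = ofFun g := by
  rw [gauge_apply, ← ofFun_mul, ← ofFun_mul, mul_right_comm, mul_comm (expFun (-f)),
    expFun_mul_expFun_neg hf, one_mul]

theorem plus_gauge (hf : constantCoeff f = 0) (P : MicroDiff (Fun A)) :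
    (gauge f hf P).plus = gauge f hf P.plus :=
  plus_ofFun_mul_mul_ofFun _ _ P

theorem gauge_eq_self_of_deriv_eq_zero (hf : constantCoeff f = 0) (hf' : f′ = 0)
    (P : MicroDiff (Fun A)) : gauge f hf P = P := by
  have hexp : (expFun f)′ = 0 := by rw [deriv_expFun hf, hf', zero_mul]
  rw [gauge_apply, mul_assoc, ← ofFun_mul_comm hexp, ← mul_assoc,
    ofFun_expFun_neg_mul_ofFun_expFun hf, one_mul]

theorem MicroDiff.IsMonic.gauge (hf : constantCoeff f = 0) {P : MicroDiff (Fun A)} {N : ℤ}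
    (hP : P.IsMonic N) : (gauge f hf P).IsMonic N := by
  have hord : P * ofFun (expFun f) ∈ orderLE (Fun A) N := by
    simpa using mul_mem_orderLE hP.mem_orderLE (ofFun_mem_orderLE (expFun f))
  have htop := coeff_mul_top hP.mem_orderLE (ofFun_mem_orderLE (expFun f))
  rw [add_zero] at htop
  rw [gauge_apply, mul_assoc]
  refine isMonic_iff.2 ⟨?_, ofFun_mul_mem_orderLE _ hord⟩
  rw [coeff_ofFun_mul, htop, hP.1, one_mul, coeff_ofFun, if_pos rfl, mul_comm,
    expFun_mul_expFun_neg hf]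

theorem tildeB_gauge (hf : constantCoeff f = 0) (P : MicroDiff (Fun A)) (n : ℕ+) :
    tildeB f (gauge f hf P) n = (P ^ (n : ℕ)).plus := by
  have hexp := ofFun_expFun_mul_ofFun_expFun_neg hf
  change ofFun (expFun f) * (gauge f hf P ^ (n : ℕ)).plus * ofFun (expFun (-f)) = _
  rw [← map_pow, plus_gauge, gauge_apply]
  simp only [mul_assoc, hexp, mul_one]
  rw [← mul_assoc, hexp, one_mul]

theorem opDeriv_gauge (hf : constantCoeff f = 0) (n : ℕ+) (P : MicroDiff (Fun A)) :
    opDeriv n (gauge f hf P) =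
      gauge f hf (opDeriv n P - (ofFun (tDeriv n f)).comm P) := by
  have hneg : constantCoeff (-f) = 0 := by rw [map_neg, hf, neg_zero]
  have hexp : ofFun (tDeriv n (-f) * expFun (-f)) =
      0 - ofFun (expFun (-f)) * ofFun (tDeriv n f) := by
    rw [map_neg, ← ofFun_mul, ← ofFun_zero, ← ofFun_sub, zero_sub, neg_mul, mul_comm]
  rw [gauge_apply, gauge_apply, opDeriv_mul, opDeriv_mul, opDeriv_ofFun, opDeriv_ofFun,
    tDeriv_expFun n hf, tDeriv_expFun n hneg, hexp, ofFun_mul (tDeriv n f), MicroDiff.comm]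
  simp only [zero_mul, add_mul, sub_mul, mul_sub, mul_assoc]
  abel

end Exponential

/-! ### Triangular changes of the time variables -/

section Triangular

open MvPowerSeries

variable {K : Type*} [CommRing K]

/-- The weight `∑ n α_n` of a monomial in the times. -/
def wt : (ℕ+ →₀ ℕ) →+ ℕ := Finsupp.weight fun n : ℕ+ => (n : ℕ)

theorem wt_single (n : ℕ+) (e : ℕ) : wt (Finsupp.single n e) = e * n := by
  rw [wt, Finsupp.weight_single, smul_eq_mul]

theorem le_wt {α : ℕ+ →₀ ℕ} {n : ℕ+} (hn : α n ≠ 0) : (n : ℕ) ≤ wt α :=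
  Finsupp.le_weight_of_ne_zero' (fun n : ℕ+ => (n : ℕ)) hn

variable (K) in
/-- The ideal of the power series all of whose monomials have weight at least `N`. -/
def wtGE (N : ℕ) : Ideal (MvPowerSeries ℕ+ K) :=
  vanishingOn K ⟨{α | wt α < N}, fun α β hβα hα => by
    rw [← add_tsub_cancel_of_le hβα, Set.mem_ofPred_eq, map_add] at hα
    exact (Nat.le_add_right _ _).trans_lt hα⟩

theorem mem_wtGE {N : ℕ} {f : MvPowerSeries ℕ+ K} :
    f ∈ wtGE K N ↔ ∀ α, wt α < N → coeff α f = 0 := Iff.rfl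

theorem wtGE_anti {N M : ℕ} (h : N ≤ M) : wtGE K M ≤ wtGE K N :=
  fun _ hf α hα => hf α (lt_of_lt_of_le hα h)

theorem mem_wtGE_zero (f : MvPowerSeries ℕ+ K) : f ∈ wtGE K 0 := fun _ hα => absurd hα (by simp)

theorem mul_mem_wtGE {N M : ℕ} {f g : MvPowerSeries ℕ+ K} (hf : f ∈ wtGE K N)
    (hg : g ∈ wtGE K M) : f * g ∈ wtGE K (N + M) := fun α hα => by
  classical
  rw [coeff_mul]
  refine sum_eq_zero fun p hp => ?_
  have hα' : wt p.1 + wt p.2 < N + M := by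
    rwa [← map_add, HasAntidiagonal.mem_antidiagonal.1 hp]
  by_cases h : wt p.1 < N
  · rw [hf _ h, zero_mul]
  · rw [hg p.2 (show wt p.2 < M by omega), mul_zero]

theorem eq_of_forall_sub_mem_wtGE {f g : MvPowerSeries ℕ+ K} (h : ∀ N, f - g ∈ wtGE K N) :
    f = g := by
  ext α
  rw [← sub_eq_zero, ← map_sub]
  exact h (wt α + 1) α (Nat.lt_succ_self _)

theorem monomial_mem_wtGE (α : ℕ+ →₀ ℕ) (c : K) : monomial α c ∈ wtGE K (wt α) := by
  classical
  refine mem_wtGE.2 fun β hβ => ?_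
  rw [coeff_monomial, if_neg]
  rintro rfl
  exact lt_irrefl _ hβ

theorem mul_sub_monomial_mem_wtGE {α β : ℕ+ →₀ ℕ} {f g : MvPowerSeries ℕ+ K}
    (hf : f - monomial α 1 ∈ wtGE K (wt α + 1)) (hg : g - monomial β 1 ∈ wtGE K (wt β + 1)) :
    f * g - monomial (α + β) 1 ∈ wtGE K (wt (α + β) + 1) := by
  have hg' : g ∈ wtGE K (wt β) := by
    rw [← sub_add_cancel g (monomial β 1)]
    exact add_mem (wtGE_anti (Nat.le_succ _) hg) (monomial_mem_wtGE β 1)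
  have h : f * g - monomial (α + β) 1 =
      (f - monomial α 1) * g + monomial α 1 * (g - monomial β 1) := by
    rw [mul_sub, monomial_mul_monomial, one_mul]
    ring
  rw [h, map_add]
  exact add_mem (wtGE_anti (by omega) (mul_mem_wtGE hf hg'))
    (wtGE_anti (by omega) (mul_mem_wtGE (monomial_mem_wtGE α 1) hg))

section Unipotent

variable {a : ℕ+ → MvPowerSeries ℕ+ K} (ha : ∀ n : ℕ+, a n - X n ∈ wtGE K (n + 1))

include ha

theorem prod_sub_monomial_mem_wtGE (α : ℕ+ →₀ ℕ) :
    (α.prod fun n e => a n ^ e) - monomial α 1 ∈ wtGE K (wt α + 1) := by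
  have hone : (1 : MvPowerSeries ℕ+ K) - monomial 0 1 ∈ wtGE K (wt 0 + 1) := by
    rw [monomial_zero_one, sub_self]
    exact zero_mem _
  induction α using Finsupp.induction_linear with
  | zero => rwa [Finsupp.prod_zero_index]
  | add α β hα hβ =>
    rw [Finsupp.prod_add_index' (fun _ => pow_zero _) fun _ _ _ => pow_add _ _ _]
    exact mul_sub_monomial_mem_wtGE hα hβ
  | single n e =>
    rw [Finsupp.prod_single_index (h := fun n e => a n ^ e) (pow_zero _)]
    induction e with
    | zero => rwa [pow_zero, Finsupp.single_zero]
    | succ e ih =>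
      rw [pow_succ, Finsupp.single_add]
      refine mul_sub_monomial_mem_wtGE ih ?_
      rw [wt_single, one_mul]
      exact ha n

theorem coeff_prod {α β : ℕ+ →₀ ℕ} (h : wt β ≤ wt α) :
    coeff β (α.prod fun n e => a n ^ e) = coeff β (monomial α (1 : K)) := by
  rw [← sub_eq_zero, ← map_sub]
  exact prod_sub_monomial_mem_wtGE ha α β (Nat.lt_succ_iff.2 h)

theorem hasSubst_of_sub_X_mem_wtGE : HasSubst a := by
  have coeff_eq_zero {n : ℕ+} {β : ℕ+ →₀ ℕ} (h : wt β < n) : coeff β (a n) = 0 := by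
    have hn : wt (Finsupp.single n 1) = n := by rw [wt_single, one_mul]
    have := coeff_prod ha (h.le.trans_eq hn.symm)
    rwa [Finsupp.prod_single_index (h := fun n e => a n ^ e) (pow_zero _), pow_one,
      monomial_mem_wtGE _ 1 β (h.trans_eq hn.symm)] at this
  refine ⟨fun n => ?_, fun β => ?_⟩
  · rw [← coeff_zero_eq_constantCoeff_apply, coeff_eq_zero (by rw [map_zero]; exact n.pos)]
    exact IsNilpotent.zero
  · refine (Set.finite_Iic (wt β).succPNat).subset fun n hn => ?_
    rw [Set.mem_Iic, ← PNat.coe_le_coe, Nat.succPNat_coe]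
    by_contra h
    exact hn (coeff_eq_zero (by omega))

theorem subst_sub_mem_wtGE {N : ℕ} {f : MvPowerSeries ℕ+ K} (hf : f ∈ wtGE K N) :
    subst a f - f ∈ wtGE K (N + 1) := fun β hβ => by
  classical
  rw [map_sub, sub_eq_zero, coeff_subst (hasSubst_of_sub_X_mem_wtGE ha), finsum_eq_single _ β]
  · rw [coeff_prod ha le_rfl, coeff_monomial_same, smul_eq_mul, mul_one]
  · intro α hα
    by_cases h : wt α < N
    · rw [hf α h, zero_smul]
    · rw [coeff_prod ha (by have : wt β < N + 1 := hβ; omega), coeff_monomial_ne hα.symm,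
        smul_zero]

end Unipotent

section RaisesWeight

variable {T : AddMonoid.End (MvPowerSeries ℕ+ K)}
  (hT : ∀ N, ∀ f ∈ wtGE K N, T f - f ∈ wtGE K (N + 1))

include hT

theorem injective_of_sub_mem_wtGE : Function.Injective T := by
  refine (injective_iff_map_eq_zero T).2 fun f hf => eq_of_forall_sub_mem_wtGE fun N => ?_
  rw [sub_zero]
  induction N with
  | zero => exact mem_wtGE_zero f
  | succ N ih =>
    have := hT N f ih
    rwa [hf, zero_sub, neg_mem_iff] at this

theorem pow_one_sub_mem_wtGE (f : MvPowerSeries ℕ+ K) (i : ℕ) : ((1 - T) ^ i) f ∈ wtGE K i := by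
  induction i with
  | zero => exact mem_wtGE_zero _
  | succ i ih =>
    have := neg_mem (hT i _ ih)
    rw [neg_sub] at this
    rwa [pow_succ']

/-- The inverse of `T` is the geometric series in `1 - T`. -/
theorem surjOn_coeffsIn_of_sub_mem_wtGE {R : Type*} [Ring R] [Module R K] {V : Submodule R K}
    (hV : Set.MapsTo T (coeffsIn ℕ+ V) (coeffsIn ℕ+ V)) :
    Set.SurjOn T (coeffsIn ℕ+ V) (coeffsIn ℕ+ V) := fun f hf => by
  let S (N : ℕ) : AddMonoid.End (MvPowerSeries ℕ+ K) := ∑ i ∈ range N, (1 - T) ^ i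
  have hS (N : ℕ) : S N f = ∑ i ∈ range N, ((1 - T) ^ i) f := AddMonoidHom.finsetSum_apply _ _ _
  let g : MvPowerSeries ℕ+ K := fun α => coeff α (S (wt α + 1) f)
  have hg (N : ℕ) : g - S N f ∈ wtGE K N := fun α hα => by
    have hα : wt α + 1 ≤ N := hα
    rw [map_sub, sub_eq_zero, hS, map_sum]
    refine (congrArg (coeff α) (hS _)).trans ((map_sum _ _ _).trans ?_)
    exact sum_subset (range_subset_range.2 hα) fun i _ hi =>
      pow_one_sub_mem_wtGE hT f i α (show wt α < i by simpa using hi)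
  have hTS (N : ℕ) : T (S N f) = f - ((1 - T) ^ N) f := by
    have := mul_neg_geom_sum (1 - T) N
    rw [sub_sub_cancel] at this
    exact DFunLike.congr_fun this f
  have hpow (i : ℕ) : ((1 - T) ^ i) f ∈ coeffsIn ℕ+ V := by
    induction i with
    | zero => exact hf
    | succ i ih =>
      rw [pow_succ', AddMonoid.End.coe_mul, Function.comp_apply]
      exact sub_mem ih (hV ih)
  refine ⟨g, fun α => ?_, eq_of_forall_sub_mem_wtGE fun N => ?_⟩
  · have : S (wt α + 1) f ∈ coeffsIn ℕ+ V := by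
      rw [hS]
      exact sum_mem fun i _ => hpow i
    exact this α
  · have h : T g - f = (T (g - S N f) - (g - S N f)) + (g - S N f) - ((1 - T) ^ N) f := by
      rw [map_sub, hTS]
      ring
    rw [h]
    exact sub_mem (add_mem (wtGE_anti (Nat.le_succ N) (hT N _ (hg N))) (hg N))
      (pow_one_sub_mem_wtGE hT f N)

end RaisesWeight

namespace IsTriangular

variable {a : ℕ+ → MvPowerSeries ℕ+ K}

theorem map (ha : IsTriangular a) {K' : Type*} [CommRing K'] (φ : K →+* K') :
    IsTriangular fun n => MvPowerSeries.map φ (a n) := fun n α h => by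
  refine ha n α fun h0 => h ?_
  rw [← map_X φ, ← map_sub, coeff_map, h0, map_zero]

theorem sub_X_mem_wtGE (ha : IsTriangular a) (n : ℕ+) : a n - X n ∈ wtGE K (n + 1) := by
  refine mem_wtGE.2 fun α hα => ?_
  by_contra h
  obtain ⟨h0, hlt⟩ := ha n α h
  obtain ⟨m, hm⟩ := Finsupp.ne_iff.1 h0
  have hnm : (n : ℕ) < m := hlt m (Finsupp.mem_support_iff.2 hm)
  exact absurd (le_wt hm) (by omega)

theorem hasSubst (ha : IsTriangular a) : HasSubst a :=
  hasSubst_of_sub_X_mem_wtGE ha.sub_X_mem_wtGE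

theorem pderiv_eq_zero (ha : IsTriangular a) {m n : ℕ+} (hmn : m < n) : pderiv K m (a n) = 0 := by
  ext α
  have h : coeff (α + Finsupp.single m 1) (a n - X n) = 0 := by
    by_contra h
    exact hmn.not_gt ((ha n _ h).2 m (by simp))
  rw [← sub_add_cancel (a n) (X n), map_add, pderiv_X_of_ne hmn.ne', add_zero, coeff_pderiv, h,
    zero_mul, map_zero]

theorem pderiv_subst (ha : IsTriangular a) (m : ℕ+) (f : MvPowerSeries ℕ+ K) :
    pderiv K m (subst a f) = ∑ n ∈ Iic m, subst a (pderiv K n f) * pderiv K m (a n) :=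
  let _ : UniformSpace K := ⊥
  derivation_subst (continuous_pderiv m) (fun _ => pderiv_C) ha.hasSubst
    (fun _ hn => ha.pderiv_eq_zero (not_le.1 (mt mem_Iic.2 hn))) f

end IsTriangular

end Triangular

section TimeChange

variable {A : Type*} [CommRing A] {τ : ℕ+ → MvPowerSeries ℕ+ A}

theorem isTriangular_ofTimes (hτ : IsTriangular τ) :
    IsTriangular (A := LaurentSeries A) fun n => ofTimes (τ n) :=
  hτ.map (K' := LaurentSeries A) HahnSeries.C

theorem timeChange_mem_coeffsIn (hτ : IsTriangular τ) {V : Submodule A (LaurentSeries A)}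
    {f : Fun A} (hf : f ∈ coeffsIn ℕ+ V) : timeChange τ f ∈ coeffsIn ℕ+ V := fun β => by
  rw [timeChange, MvPowerSeries.coeff_subst (isTriangular_ofTimes hτ).hasSubst]
  refine finsum_induction (· ∈ V) (zero_mem _) (fun _ _ => add_mem) fun α => ?_
  have h : (α.prod fun n e => ofTimes (τ n) ^ e) = ofTimes (α.prod fun n e => τ n ^ e) := by
    simp only [Finsupp.prod, map_prod, map_pow]
  rw [h, ofTimes, MvPowerSeries.coeff_map, smul_eq_mul, mul_comm, HahnSeries.C_mul_eq_smul]
  exact V.smul_mem _ (hf α)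

theorem bijOn_timeChange (hτ : IsTriangular τ) (I : AddSubmonoid ℕ) :
    Set.BijOn (timeChange τ) (bddSubring A I) (bddSubring A I) := by
  let T : AddMonoid.End (Fun A) := AddMonoidHom.mk' (timeChange τ)
    (MvPowerSeries.subst_add (isTriangular_ofTimes hτ).hasSubst)
  have hT (N : ℕ) (f : Fun A) (hf : f ∈ wtGE (LaurentSeries A) N) :
      T f - f ∈ wtGE (LaurentSeries A) (N + 1) :=
    subst_sub_mem_wtGE (isTriangular_ofTimes hτ).sub_X_mem_wtGE hf
  have hinj : Function.Injective (timeChange τ) := injective_of_sub_mem_wtGE hT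
  refine ⟨?_, hinj.injOn, ?_⟩
  · rintro f ⟨N, hN, hf⟩
    exact ⟨N, hN, timeChange_mem_coeffsIn hτ hf⟩
  · rintro f ⟨N, hN, hf⟩
    have hmaps : Set.MapsTo T (coeffsIn ℕ+ (poleLE A N)) (coeffsIn ℕ+ (poleLE A N)) :=
      fun f hf => timeChange_mem_coeffsIn hτ hf
    obtain ⟨h, hh, e⟩ := surjOn_coeffsIn_of_sub_mem_wtGE hT hmaps hf
    exact ⟨h, ⟨N, hN, hh⟩, e⟩

theorem tDeriv_timeChange (hτ : IsTriangular τ) (m : ℕ+) (f : Fun A) :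
    tDeriv m (timeChange τ f) =
      ∑ n ∈ Iic m, timeChange τ (tDeriv n f) * tDeriv m (ofTimes (τ n)) :=
  (isTriangular_ofTimes hτ).pderiv_subst m f

end TimeChange

/-! ### Power series in the higher times -/

section HigherTimes

open MvPowerSeries

variable {K : Type*} [CommRing K]

variable (K) in
/-- The ideal of the power series that vanish when `t_n = 0` for all `n ≥ N`. -/
def higherTimes (N : ℤ) : Ideal (MvPowerSeries ℕ+ K) :=
  vanishingOn K ⟨{α | ∀ n : ℕ+, N ≤ n → α n = 0}, fun _ _ hβα hα n hn =>
    Nat.le_zero.1 ((hβα n).trans_eq (hα n hn))⟩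

theorem mem_higherTimes {N : ℤ} {f : MvPowerSeries ℕ+ K} :
    f ∈ higherTimes K N ↔ ∀ α : ℕ+ →₀ ℕ, (∀ n : ℕ+, N ≤ n → α n = 0) → coeff α f = 0 := Iff.rfl

theorem higherTimes_anti {N M : ℤ} (h : N ≤ M) : higherTimes K M ≤ higherTimes K N :=
  fun _ hf α hα => hf α fun n hn => hα n (h.trans hn)

theorem coeff_eq_zero_of_mem_higherTimes {N : ℤ} {f : MvPowerSeries ℕ+ K}
    (hf : f ∈ higherTimes K N) {α : ℕ+ →₀ ℕ} (hα : wt α < N) : coeff α f = 0 :=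
  hf α fun n hn => by
    by_contra h
    have := le_wt h
    omega

theorem eq_of_forall_sub_mem_higherTimes {f g : MvPowerSeries ℕ+ K} (N₀ : ℤ)
    (h : ∀ N ≥ N₀, f - g ∈ higherTimes K N) : f = g := by
  ext α
  rw [← sub_eq_zero, ← map_sub]
  exact coeff_eq_zero_of_mem_higherTimes (h _ (le_max_left N₀ (wt α + 1))) (by omega)

theorem pderiv_mem_higherTimes {n : ℕ+} {N : ℤ} (hn : n < N) {f : MvPowerSeries ℕ+ K}
    (hf : f ∈ higherTimes K N) : pderiv K n f ∈ higherTimes K N :=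
  pderiv_mem_vanishingOn (fun α hα m hm => by
    have hnm : n ≠ m := by rintro rfl; omega
    rw [Finsupp.add_apply, hα m hm, Finsupp.single_eq_of_ne hnm.symm, add_zero]) hf

theorem sub_C_constantCoeff_mem_higherTimes [IsAddTorsionFree K] {N : ℤ}
    {f : MvPowerSeries ℕ+ K} (hf : ∀ n : ℕ+, n < N → pderiv K n f = 0) :
    f - C (constantCoeff f) ∈ higherTimes K N := mem_higherTimes.2 fun α hα => by
  classical
  rw [map_sub, coeff_C]
  split_ifs with h0
  · rw [h0, coeff_zero_eq_constantCoeff_apply, sub_self]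
  · obtain ⟨n, hn⟩ := Finsupp.ne_iff.1 h0
    have h := coeff_pderiv_sub_single hn f
    rw [hf n (not_le.1 (mt (hα n) hn)), map_zero] at h
    rw [sub_zero, (nsmul_eq_zero_iff_right hn).1 h.symm]

theorem exists_forall_sub_mem_higherTimes {f : ℕ → MvPowerSeries ℕ+ K} {c : ℤ} {m₀ : ℕ}
    (h : ∀ m ≥ m₀, f (m + 1) - f m ∈ higherTimes K (m + c)) :
    ∃ g : MvPowerSeries ℕ+ K, (∀ m ≥ m₀, g - f m ∈ higherTimes K (m + c)) ∧
      ∀ α, ∃ m ≥ m₀, coeff α g = coeff α (f m) := by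
  have hle {m m' : ℕ} (hm : m₀ ≤ m) (hmm' : m ≤ m') : f m' - f m ∈ higherTimes K (m + c) := by
    induction m', hmm' using Nat.le_induction with
    | base => rw [sub_self]; exact zero_mem _
    | succ m' hm' ih =>
      rw [← sub_add_sub_cancel]
      exact add_mem (higherTimes_anti (by omega) (h m' (hm.trans hm'))) ih
  have (α : ℕ+ →₀ ℕ) : ∃ N ≥ m₀, wt α < N + c := ⟨max m₀ (wt α + 1 - c).toNat, by omega, by omega⟩
  choose N hN hwt using this
  refine ⟨fun α => coeff α (f (N α)), fun m hm => mem_higherTimes.2 fun α hα => ?_,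
    fun α => ⟨N α, hN α, rfl⟩⟩
  change coeff α (f (N α)) - coeff α (f m) = 0
  rw [← map_sub]
  rcases le_total m (N α) with hmN | hNm
  · exact hle hm hmN α hα
  · rw [← neg_sub, map_neg, neg_eq_zero]
    exact coeff_eq_zero_of_mem_higherTimes (hle (hN α) hNm) (hwt α)

end HigherTimes

namespace MicroDiff

variable {R : Type*} [CommRing R] [Differential R] {J : Ideal R} {P Z : MicroDiff R} {n k : ℤ}

theorem coeff_mul_mem_of_mem_orderLE_left (hJ : ∀ a ∈ J, a′ ∈ J) (hP : P ∈ orderLE R n)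
    (hZ : ∀ j, k - n ≤ j → Z.coeff j ∈ J) : (P * Z).coeff k ∈ J := by
  have iterDeriv_mem (r : ℕ) {a : R} (ha : a ∈ J) : iterDeriv R r a ∈ J := by
    induction r with
    | zero => exact ha
    | succ r ih => rw [iterDeriv_succ]; exact hJ _ ih
  rw [coeff_mul]
  refine finsum_induction (· ∈ J) (zero_mem J) (fun _ _ => add_mem) fun p => zsmul_mem ?_ _
  by_cases hp : n < p.1
  · rw [mem_orderLE.1 hP _ hp, zero_mul]
    exact zero_mem J
  · exact J.mul_mem_left _ (iterDeriv_mem _ (hZ _ (by omega)))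

theorem coeff_mul_mem_of_mem_orderLE_right (hP : P ∈ orderLE R n)
    (hZ : ∀ j, k - n ≤ j → Z.coeff j ∈ J) : (Z * P).coeff k ∈ J := by
  rw [coeff_mul]
  refine finsum_induction (· ∈ J) (zero_mem J) (fun _ _ => add_mem) fun p => zsmul_mem ?_ _
  by_cases hp : n < k - p.1 + p.2
  · rw [mem_orderLE.1 hP _ hp, map_zero, mul_zero]
    exact zero_mem J
  · exact J.mul_mem_right _ (hZ _ (by omega))

end MicroDiff

section HigherTimesFun

variable {A : Type*} [CommRing A]

theorem deriv_mem_higherTimes {N : ℤ} (f : Fun A) (hf : f ∈ higherTimes (LaurentSeries A) N) :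
    f′ ∈ higherTimes (LaurentSeries A) N := mem_higherTimes.2 fun α hα => by
  change LaurentSeries.derivative ℤ (MvPowerSeries.coeff α f) = 0
  rw [mem_higherTimes.1 hf α hα, map_zero]

theorem ofTimes_mem_higherTimes {N : ℤ} {g : MvPowerSeries ℕ+ A} (hg : g ∈ higherTimes A N) :
    ofTimes g ∈ higherTimes (LaurentSeries A) N := mem_higherTimes.2 fun α hα => by
  rw [ofTimes, MvPowerSeries.coeff_map, mem_higherTimes.1 hg α hα, map_zero]

end HigherTimesFun

/-! ### The solution of the linear problem -/

section Approximation

open MicroDiff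

variable {A : Type*} [CommRing A]

/-- The sum `∑_{k ∈ s} g_k u^k`, whose coefficients `g_k` do not depend on `x`. -/
def zpowSum (u : (MicroDiff (Fun A))ˣ) (s : Finset ℤ) (g : ℤ → MvPowerSeries ℕ+ A) :
    MicroDiff (Fun A) := ∑ k ∈ s, ofFun (ofTimes (g k)) * (u ^ k).val

section ZPowSum

variable {u : (MicroDiff (Fun A))ˣ} {s : Finset ℤ} {g : ℤ → MvPowerSeries ℕ+ A}

theorem coeff_zpowSum (k : ℤ) :
    (zpowSum u s g).coeff k = ∑ j ∈ s, ofTimes (g j) * (u ^ j).val.coeff k := by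
  simp only [zpowSum, coeff_sum, coeff_ofFun_mul]

theorem zpowSum_sub (h : ℤ → MvPowerSeries ℕ+ A) :
    zpowSum u s (fun k => g k - h k) = zpowSum u s g - zpowSum u s h := by
  simp only [zpowSum, map_sub, ofFun_sub, sub_mul, sum_sub_distrib]

theorem zpowSum_mem_opSubring {I : AddSubmonoid ℕ} (hu : u.val.IsMonic 1)
    (huI : u.val ∈ opSubring (bddSubring A I) deriv_mem_bddSubring) :
    zpowSum u s g ∈ opSubring (bddSubring A I) deriv_mem_bddSubring :=
  sum_mem fun k _ => mul_mem (ofFun_mem_opSubring (ofTimes_mem_bddSubring _))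
    (zpow_mem_opSubring hu huI k)

theorem coeff_zpowSum_top (hu : u.val.IsMonic 1) {N : ℤ} (hs : ∀ k ∈ s, k ≤ N) (hN : N ∈ s) :
    (zpowSum u s g).coeff N = ofTimes (g N) := by
  rw [coeff_zpowSum, sum_eq_single_of_mem N hN, (isMonic_zpow hu N).1, mul_one]
  intro k hk hkN
  rw [mem_orderLE.1 (isMonic_zpow hu k).mem_orderLE N ((hs k hk).lt_of_ne hkN), mul_zero]

theorem isMonic_zpowSum (hu : u.val.IsMonic 1) {N : ℤ} (hs : ∀ k ∈ s, k ≤ N) (hN : N ∈ s)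
    (hg : g N = 1) : (zpowSum u s g).IsMonic N := by
  refine isMonic_iff.2 ⟨?_, sum_mem fun k hk => ofFun_mul_mem_orderLE _
    (orderLE_mono (hs k hk) (isMonic_zpow hu k).mem_orderLE)⟩
  rw [coeff_zpowSum_top hu hs hN, hg, map_one]

theorem coeff_zpowSum_mem_higherTimes (hu : u.val.IsMonic 1) {k N : ℤ}
    (hg : ∀ j ∈ s, k ≤ j → g j ∈ higherTimes A N) :
    (zpowSum u s g).coeff k ∈ higherTimes (LaurentSeries A) N := by
  rw [coeff_zpowSum]
  refine sum_mem fun j hj => ?_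
  by_cases hkj : k ≤ j
  · exact Ideal.mul_mem_right _ _ (ofTimes_mem_higherTimes (hg j hj hkj))
  · rw [mem_orderLE.1 (isMonic_zpow hu j).mem_orderLE k (not_le.1 hkj), mul_zero]
    exact zero_mem _

theorem eq_zero_of_zpowSum_mem_orderLE (hu : u.val.IsMonic 1) {d : ℤ}
    (h : zpowSum u s g ∈ orderLE (Fun A) d) {k : ℤ} (hk : k ∈ s) (hdk : d < k) : g k = 0 :=
  ofTimes_injective (by
    rw [map_zero]
    exact eq_zero_of_sum_ofFun_mul_mem_orderLE (isMonic_zpow hu) h k hk hdk)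

end ZPowSum

/-- The derivation `P ↦ ∂P/∂t_n - [B_n, P]`. -/
def zsDeriv (B : ℕ+ → MicroDiff (Fun A)) (n : ℕ+) : MicroDiff (Fun A) →+ MicroDiff (Fun A) :=
  opDerivHom n - (AddMonoidHom.mulLeft (B n) - AddMonoidHom.mulRight (B n))

variable {B : ℕ+ → MicroDiff (Fun A)}

theorem zsDeriv_apply (n : ℕ+) (P : MicroDiff (Fun A)) :
    zsDeriv B n P = opDeriv n P - (B n).comm P := rfl

theorem zsDeriv_mul (n : ℕ+) (P Q : MicroDiff (Fun A)) :
    zsDeriv B n (P * Q) = zsDeriv B n P * Q + P * zsDeriv B n Q := by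
  simp only [zsDeriv_apply, MicroDiff.comm, opDeriv_mul, sub_mul, mul_sub, mul_assoc]
  abel

theorem zsDeriv_ofFun_ofTimes (n : ℕ+) (g : MvPowerSeries ℕ+ A) :
    zsDeriv B n (ofFun (ofTimes g)) = ofFun (ofTimes (MvPowerSeries.pderiv A n g)) := by
  rw [zsDeriv_apply, opDeriv_ofFun, tDeriv_ofTimes, MicroDiff.comm,
    ofFun_mul_comm (xDeriv_ofTimes g), sub_self, sub_zero]

theorem zsDeriv_zpowSum_sub_mem_orderLE {u : (MicroDiff (Fun A))ˣ} (hu : u.val.IsMonic 1)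
    {n : ℕ+} {d : ℤ} (hd : zsDeriv B n u.val ∈ orderLE (Fun A) d) {s : Finset ℤ}
    (hs : ∀ k ∈ s, k ≤ 1) (g : ℤ → MvPowerSeries ℕ+ A) :
    zsDeriv B n (zpowSum u s g) - zpowSum u s (fun k => MvPowerSeries.pderiv A n (g k)) ∈
      orderLE (Fun A) d := by
  rw [zpowSum, zpowSum, map_sum, ← sum_sub_distrib]
  refine sum_mem fun k hk => ?_
  rw [zsDeriv_mul, zsDeriv_ofFun_ofTimes, add_sub_cancel_left]
  exact ofFun_mul_mem_orderLE _ (orderLE_mono (by have := hs k hk; omega)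
    (derivation_zpow_mem_orderLE (zsDeriv_mul n) hu hd k))

/-- Monic differential operators `B_n` of order `n` that solve the Zakharov-Shabat equations, with
coefficients in `A[[t]][[x]]` (`I = ⊥`) or in `A[[t]]((x))` (`I = ⊤`). -/
structure ZSSystem (I : AddSubmonoid ℕ) (B : ℕ+ → MicroDiff (Fun A)) : Prop where
  mem : ∀ n, B n ∈ opSubring (bddSubring A I) deriv_mem_bddSubring
  isDifferential : ∀ n, (B n).IsDifferential
  isMonic : ∀ n : ℕ+, (B n).IsMonic (n : ℕ)
  zakharovShabat : ZakharovShabat B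

/-- Monic operators `X` of order one for which `∂X/∂t_n - [B_n, X]` has order at most `n - m`. -/
structure IsApprox (I : AddSubmonoid ℕ) (B : ℕ+ → MicroDiff (Fun A)) (m : ℕ)
    (X : MicroDiff (Fun A)) : Prop where
  isMonic : X.IsMonic 1
  mem : X ∈ opSubring (bddSubring A I) deriv_mem_bddSubring
  zsDeriv_mem : ∀ n : ℕ+, zsDeriv B n X ∈ orderLE (Fun A) (n - m)

variable {I : AddSubmonoid ℕ}

theorem IsApprox.mono {m m' : ℕ} (h : m' ≤ m) {X : MicroDiff (Fun A)} (hX : IsApprox I B m X) :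
    IsApprox I B m' X :=
  ⟨hX.isMonic, hX.mem, fun n => orderLE_mono (by omega) (hX.zsDeriv_mem n)⟩

namespace ZSSystem

theorem zsDeriv_B (hB : ZSSystem I B) (n m : ℕ+) : zsDeriv B n (B m) = opDeriv m (B n) := by
  rw [zsDeriv_apply, ← sub_eq_zero, ← neg_eq_zero, ← hB.zakharovShabat n m]
  abel

theorem zsDeriv_mem_orderLE (hB : ZSSystem I B) (n : ℕ+) {P : MicroDiff (Fun A)} {N : ℤ}
    (hP : P ∈ orderLE (Fun A) N) : zsDeriv B n P ∈ orderLE (Fun A) (N + n - 1) := by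
  have hn := n.pos
  exact sub_mem (orderLE_mono (by omega) (opDeriv_mem_orderLE n hP))
    (orderLE_mono (by omega) (comm_mem_orderLE (hB.isMonic n).mem_orderLE hP))

theorem coeff_zsDeriv_top (hB : ZSSystem I B) {n : ℕ+} (hn : 1 < n) {P : MicroDiff (Fun A)} {N : ℤ}
    (hP : P ∈ orderLE (Fun A) N) :
    (zsDeriv B n P).coeff (N + n - 1) = -((n : ℕ) • (P.coeff N)′) := by
  have hn' : 1 < (n : ℕ) := hn
  rw [zsDeriv_apply, coeff_sub, mem_orderLE.1 (opDeriv_mem_orderLE n hP) _ (by omega), zero_sub,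
    add_comm N, MicroDiff.IsMonic.coeff_comm (hB.isMonic n) hP, natCast_zsmul]

/-- An `m`-th root of `B_m` up to order `0` serves. -/
theorem exists_isApprox [Algebra ℚ A] (hB : ZSSystem I B) {m : ℕ} (hm : m ≠ 0) :
    ∃ X, IsApprox I B m X := by
  have := IsAddTorsionFree.of_module_rat (Fun A)
  let b : ℕ+ := ⟨m, Nat.pos_of_ne_zero hm⟩
  obtain ⟨X, hXI, hX, hord⟩ :=
    (hB.isMonic b).exists_approx_root (exists_natCast_mul_eq hm) (hB.mem b) (m - 1)
  refine ⟨X, hX, hXI, fun n => mem_orderLE_of_derivation_pow (zsDeriv_mul n) hX hm ?_⟩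
  rw [← sub_add_cancel (X ^ m) (B b), map_add, hB.zsDeriv_B]
  change X ^ m - B b ∈ orderLE _ ((m : ℤ) - 1 - (m - 1 : ℕ)) at hord
  exact add_mem (orderLE_mono (by omega) (hB.zsDeriv_mem_orderLE n hord))
    (orderLE_mono (by omega) ((hB.isMonic n).opDeriv_mem_orderLE b))

section Compare

variable {m : ℕ} {X : MicroDiff (Fun A)} {u : (MicroDiff (Fun A))ˣ}

/-- For `n > m` the leading coefficient of an operator `P` of order `> 1 - m` cannot depend on `x`
if `zsDeriv B n P` has order at most `n - m`. -/
theorem exists_sub_zpowSum_mem_orderLE [Algebra ℚ A] (hB : ZSSystem I B) (hm : m ≠ 0)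
    (hX : IsApprox I B m X) (hu : IsApprox I B m u.val) :
    ∃ g, X - zpowSum u (Ioc (1 - m) 1) g ∈ orderLE (Fun A) (1 - m) := by
  have := IsAddTorsionFree.of_module_rat (Fun A)
  have := IsAddTorsionFree.of_module_rat A
  let n : ℕ+ := m.succPNat
  have hn : (n : ℕ) = m + 1 := rfl
  have hD {P : MicroDiff (Fun A)} (hP : zsDeriv B n P ∈ orderLE (Fun A) 1) :
      P ∈ (orderLE (Fun A) 1).comap (zsDeriv B n) := hP
  obtain ⟨a, ha, hord⟩ := exists_expansion (isMonic_zpow hu.isMonic)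
    (V := (ofTimes (A := A)).range.toAddSubgroup) (d := 1 - m) (N := 1)
    (fun P hP j hj hPj => by
      have h := hB.coeff_zsDeriv_top (show 1 < (n : ℕ) by omega) hPj
      rw [mem_orderLE.1 (show zsDeriv B n P ∈ orderLE (Fun A) 1 from hP) _ (by omega), zero_eq_neg,
        nsmul_eq_zero_iff_right n.ne_zero] at h
      exact ⟨_, (eq_ofTimes_xCoeff_zero h).symm⟩)
    (by omega)
    (by
      rintro _ ⟨g, rfl⟩ k hk
      refine hD ?_
      rw [zsDeriv_mul, zsDeriv_ofFun_ofTimes]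
      exact add_mem
        (ofFun_mul_mem_orderLE _ (orderLE_mono hk (isMonic_zpow hu.isMonic k).mem_orderLE))
        (ofFun_mul_mem_orderLE _ (orderLE_mono (by omega)
          (derivation_zpow_mem_orderLE (zsDeriv_mul n) hu.isMonic (hu.zsDeriv_mem n) k))))
    (hD (orderLE_mono (by omega) (hX.zsDeriv_mem n))) hX.isMonic.mem_orderLE
  choose g hg using ha
  exact ⟨g, by simpa only [zpowSum, hg] using hord⟩

variable {g : ℤ → MvPowerSeries ℕ+ A}
  (hg : X - zpowSum u (Ioc (1 - m) 1) g ∈ orderLE (Fun A) (1 - m))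
include hg

theorem eq_one_of_sub_zpowSum_mem_orderLE (hm : m ≠ 0) (hX : X.IsMonic 1) (hu : u.val.IsMonic 1) :
    g 1 = 1 := ofTimes_injective <| by
  have h := mem_orderLE.1 hg 1 (by omega)
  rw [coeff_sub, hX.1, coeff_zpowSum_top hu (fun k hk => (mem_Ioc.1 hk).2)
    (mem_Ioc.2 ⟨by omega, le_rfl⟩), sub_eq_zero] at h
  rw [← h, map_one]

theorem pderiv_eq_zero_of_sub_zpowSum_mem_orderLE (hB : ZSSystem I B) (hX : IsApprox I B m X)
    (hu : IsApprox I B m u.val) {k : ℤ} (hk : k ∈ Ioc (1 - m : ℤ) 1) {n : ℕ+} (hn : n < m + k) :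
    MvPowerSeries.pderiv A n (g k) = 0 := by
  have hsum : zsDeriv B n (zpowSum u (Ioc (1 - m) 1) g) ∈ orderLE (Fun A) (n - m) := by
    rw [← sub_sub_self X (zpowSum u (Ioc (1 - m) 1) g), map_sub]
    exact sub_mem (hX.zsDeriv_mem n) (orderLE_mono (by omega) (hB.zsDeriv_mem_orderLE n hg))
  refine eq_zero_of_zpowSum_mem_orderLE (g := fun k => MvPowerSeries.pderiv A n (g k)) hu.isMonic
    (d := n - m) ?_ hk (by omega)
  rw [← sub_sub_self (zsDeriv B n (zpowSum u (Ioc (1 - m) 1) g))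
    (zpowSum u (Ioc (1 - m) 1) fun k => MvPowerSeries.pderiv A n (g k))]
  exact sub_mem hsum (zsDeriv_zpowSum_sub_mem_orderLE hu.isMonic (hu.zsDeriv_mem n)
    (fun k hk => (mem_Ioc.1 hk).2) g)

end Compare

theorem exists_forall_coeff_mem_coeffsIn [Algebra ℚ A] (hB : ZSSystem I B) {m : ℕ} (hm : m ≠ 0)
    {k : ℤ} (hk : 2 - m ≤ k) :
    ∃ N ∈ I, ∀ X, IsApprox I B m X → X.coeff k ∈ coeffsIn ℕ+ (poleLE A N) := by
  obtain ⟨Y, hY⟩ := hB.exists_isApprox hm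
  obtain ⟨u, rfl⟩ := hY.isMonic.isUnit
  choose N hNI hN using fun j : ℤ =>
    mem_bddSubring.1 (mem_opSubring.1 (zpow_mem_opSubring hY.isMonic hY.mem j) k)
  refine ⟨∑ j ∈ Ioc (1 - m : ℤ) 1, N j, sum_mem fun j _ => hNI j, fun X hX => ?_⟩
  obtain ⟨g, hg⟩ := hB.exists_sub_zpowSum_mem_orderLE hm hX hY
  have h := mem_orderLE.1 hg k (by omega)
  rw [coeff_sub, coeff_zpowSum, sub_eq_zero] at h
  rw [h]
  refine sum_mem fun j hj α => poleLE_mono ?_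
    (mul_mem_coeffsIn_poleLE (ofTimes_mem_coeffsIn_poleLE 0 (g j)) (hN j) α)
  rw [zero_add]
  exact single_le_sum (fun _ _ => Nat.zero_le _) hj

/-- Replacing the coefficients in the expansion of `X` in powers of a better approximation by their
values at `t = 0` improves `X`. -/
theorem exists_next [Algebra ℚ A] (hB : ZSSystem I B) {m : ℕ} (hm : m ≠ 0) {X : MicroDiff (Fun A)}
    (hX : IsApprox I B m X) : ∃ Y, IsApprox I B (m + 1) Y ∧
      ∀ k : ℤ, 2 - m ≤ k → (Y - X).coeff k ∈ higherTimes (LaurentSeries A) (m + k) := by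
  have := IsAddTorsionFree.of_module_rat A
  obtain ⟨Y, hY⟩ := hB.exists_isApprox m.succ_ne_zero
  obtain ⟨u, rfl⟩ := hY.isMonic.isUnit
  have hu := hY.mono m.le_succ
  obtain ⟨g, hg⟩ := hB.exists_sub_zpowSum_mem_orderLE hm hX hu
  let c (k : ℤ) : MvPowerSeries ℕ+ A := MvPowerSeries.C (MvPowerSeries.constantCoeff (g k))
  have hs : ∀ k ∈ Ioc (1 - m : ℤ) 1, k ≤ 1 := fun k hk => (mem_Ioc.1 hk).2
  have hc1 : c 1 = 1 := by
    simp only [c, eq_one_of_sub_zpowSum_mem_orderLE hg hm hX.isMonic hY.isMonic, map_one]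
  refine ⟨zpowSum u (Ioc (1 - m) 1) c, ⟨isMonic_zpowSum hY.isMonic hs
    (mem_Ioc.2 ⟨by omega, le_rfl⟩) hc1, zpowSum_mem_opSubring hY.isMonic hY.mem, fun n => ?_⟩,
    fun k hk => ?_⟩
  · have h := zsDeriv_zpowSum_sub_mem_orderLE hY.isMonic (hY.zsDeriv_mem n) hs c
    simpa only [zpowSum, c, MvPowerSeries.pderiv_C, map_zero, ofFun_zero, zero_mul, sum_const_zero,
      sub_zero] using h
  · rw [← sub_add_sub_cancel _ (zpowSum u (Ioc (1 - m) 1) g), coeff_add, ← neg_sub X, coeff_neg,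
      mem_orderLE.1 hg k (by omega), neg_zero, add_zero, ← zpowSum_sub]
    refine coeff_zpowSum_mem_higherTimes hY.isMonic fun j hj hkj => higherTimes_anti
      (show (m : ℤ) + k ≤ m + j by omega) ?_
    rw [← neg_sub]
    exact neg_mem (sub_C_constantCoeff_mem_higherTimes fun n hn =>
      pderiv_eq_zero_of_sub_zpowSum_mem_orderLE hg hB hX hu hj hn)

theorem exists_seq [Algebra ℚ A] (hB : ZSSystem I B) : ∃ X : ℕ → MicroDiff (Fun A),
    ∀ m ≠ 0, IsApprox I B m (X m) ∧ ∀ k : ℤ, 2 - m ≤ k →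
      (X (m + 1) - X m).coeff k ∈ higherTimes (LaurentSeries A) (m + k) := by
  obtain ⟨X₁, hX₁⟩ := hB.exists_isApprox one_ne_zero
  choose! next hnext using fun (m : ℕ) (hm : m ≠ 0) (X : MicroDiff (Fun A)) =>
    hB.exists_next hm (X := X)
  let X (m : ℕ) : MicroDiff (Fun A) := Nat.rec X₁ (fun i => next (i + 1)) (m - 1)
  have happrox (i : ℕ) : IsApprox I B (i + 1) (X (i + 1)) := by
    induction i with
    | zero => exact hX₁
    | succ i ih => exact (hnext (i + 1) i.succ_ne_zero _ ih).1
  refine ⟨X, fun m hm => ?_⟩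
  obtain ⟨i, rfl⟩ := Nat.exists_eq_succ_of_ne_zero hm
  exact ⟨happrox i, (hnext (i + 1) i.succ_ne_zero _ (happrox i)).2⟩

theorem exists_limit [Algebra ℚ A] (hB : ZSSystem I B) : ∃ M : MicroDiff (Fun A), M.IsMonic 1 ∧
    M ∈ opSubring (bddSubring A I) deriv_mem_bddSubring ∧
    ∃ X : ℕ → MicroDiff (Fun A), ∀ m ≠ 0, IsApprox I B m (X m) ∧ ∀ k : ℤ, 2 - m ≤ k →
      (M - X m).coeff k ∈ higherTimes (LaurentSeries A) (m + k) := by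
  obtain ⟨X, hX⟩ := hB.exists_seq
  have hm₀ {k : ℤ} {m : ℕ} : max 1 (2 - k).toNat ≤ m ↔ m ≠ 0 ∧ 2 - m ≤ k := by omega
  choose c hcX hc using fun k : ℤ => exists_forall_sub_mem_higherTimes
    (f := fun m => (X m).coeff k) (c := k) fun m hm => (hX m (hm₀.1 hm).1).2 k (hm₀.1 hm).2
  have hc_eq {k : ℤ} {f : Fun A} (hf : ∀ P : MicroDiff (Fun A), P.IsMonic 1 → P.coeff k = f) :
      c k = f := by
    ext1 α
    obtain ⟨m, hm, h⟩ := hc k α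
    rw [h, hf _ (hX m (hm₀.1 hm).1).1.isMonic]
  let M : MicroDiff (Fun A) := ⟨c, 1, fun k hk => hc_eq fun P hP => hP.2 k hk⟩
  refine ⟨M, ⟨hc_eq fun P hP => hP.1, fun k hk => hc_eq fun P hP => hP.2 k hk⟩,
    mem_opSubring.2 fun k => ?_, X, fun m hm => ⟨(hX m hm).1, fun k hk => hcX k m (hm₀.2 ⟨hm, hk⟩)⟩⟩
  obtain ⟨N, hN, hNX⟩ := hB.exists_forall_coeff_mem_coeffsIn (hm₀.1 le_rfl).1 (hm₀.1 le_rfl).2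
  refine mem_bddSubring.2 ⟨N, hN, fun α => ?_⟩
  obtain ⟨m, hm, h⟩ := hc k α
  change MvPowerSeries.coeff α (c k) ∈ _
  rw [h]
  exact hNX _ ((hX m (hm₀.1 hm).1).1.mono hm) α

theorem exists_solution [Algebra ℚ A] (hB : ZSSystem I B) : ∃ M : MicroDiff (Fun A), M.IsMonic 1 ∧
    M ∈ opSubring (bddSubring A I) deriv_mem_bddSubring ∧ ∀ n, zsDeriv B n M = 0 := by
  obtain ⟨M, hM, hMI, X, hX⟩ := hB.exists_limit
  refine ⟨M, hM, hMI, fun n => ?_⟩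
  ext1 k
  refine eq_of_forall_sub_mem_higherTimes (n + k.natAbs + 2) fun N hN => ?_
  obtain ⟨m, hm⟩ : ∃ m : ℕ, (m : ℤ) = N + n - k := ⟨(N + n - k).toNat, by omega⟩
  obtain ⟨happrox, hlim⟩ := hX m (by omega)
  have hmem (j : ℤ) (hj : k - n ≤ j) : (M - X m).coeff j ∈ higherTimes (LaurentSeries A) N :=
    higherTimes_anti (by omega) (hlim j (by omega))
  rw [coeff_zero, sub_zero, ← sub_add_cancel M (X m), map_add, coeff_add,
    mem_orderLE.1 (happrox.zsDeriv_mem n) k (by omega), add_zero, zsDeriv_apply, coeff_sub,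
    coeff_opDeriv, MicroDiff.comm, coeff_sub]
  exact sub_mem (pderiv_mem_higherTimes (by omega) (hmem k (by omega))) (sub_mem
    (coeff_mul_mem_of_mem_orderLE_left deriv_mem_higherTimes (hB.isMonic n).mem_orderLE hmem)
    (coeff_mul_mem_of_mem_orderLE_right (hB.isMonic n).mem_orderLE hmem))

end ZSSystem

end Approximation

/-! ### Expansion in powers of the solution -/

section Expansion

open MicroDiff

variable {A : Type*} [CommRing A] {u : (MicroDiff (Fun A))ˣ}

theorem commute_ofFun_ofTimes (f : MvPowerSeries ℕ+ A) (P : MicroDiff (Fun A)) :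
    Commute (ofFun (ofTimes f)) P :=
  ofFun_mul_comm (xDeriv_ofTimes f) P

theorem commute_zpowSum_zpow (s : Finset ℤ) (g : ℤ → MvPowerSeries ℕ+ A) (j : ℤ) :
    Commute (zpowSum u s g) (u ^ j).val :=
  Commute.sum_left _ _ _ fun k _ => (commute_ofFun_ofTimes (g k) _).mul_left
    (Commute.zpow_zpow_self u k j).units_val

theorem commute_zpowSum_zpowSum (s t : Finset ℤ) (g h : ℤ → MvPowerSeries ℕ+ A) :
    Commute (zpowSum u s g) (zpowSum u t h) :=
  Commute.sum_right _ _ _ fun k _ => (commute_ofFun_ofTimes (h k) _).symm.mul_right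
    (commute_zpowSum_zpow s g k)

variable {B : ℕ+ → MicroDiff (Fun A)}

theorem zsDeriv_zpow_eq_zero (hu : u.val.IsMonic 1) {n : ℕ+} (hn : zsDeriv B n u.val = 0) (k : ℤ) :
    zsDeriv B n (u ^ k).val = 0 :=
  eq_zero_of_forall_mem_orderLE fun d => by
    have hd : zsDeriv B n u.val ∈ orderLE (Fun A) (-d - k + 1) := hn ▸ zero_mem _
    exact orderLE_mono (by omega) (derivation_zpow_mem_orderLE (zsDeriv_mul n) hu hd k)

theorem zsDeriv_zpowSum (hu : u.val.IsMonic 1) {n : ℕ+} (hn : zsDeriv B n u.val = 0)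
    (s : Finset ℤ) (g : ℤ → MvPowerSeries ℕ+ A) :
    zsDeriv B n (zpowSum u s g) = zpowSum u s fun k => MvPowerSeries.pderiv A n (g k) := by
  simp only [zpowSum, map_sum, zsDeriv_mul, zsDeriv_ofFun_ofTimes, zsDeriv_zpow_eq_zero hu hn,
    mul_zero, add_zero]

theorem comm_eq_opDeriv {X : MicroDiff (Fun A)} {n : ℕ+} (hX : zsDeriv B n X = 0) :
    (B n).comm X = opDeriv n X :=
  (sub_eq_zero.1 (zsDeriv_apply n X ▸ hX)).symm

/-- Expansions `B_n = ∑_{k = 1}^n g_{n,k} u^k + Z_n` with `g_{n,n} = 1` and `Z_n` of order at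
most `0`. -/
structure IsExpansion (B : ℕ+ → MicroDiff (Fun A)) (u : (MicroDiff (Fun A))ˣ)
    (g : ℕ+ → ℤ → MvPowerSeries ℕ+ A) (Z : ℕ+ → MicroDiff (Fun A)) : Prop where
  self_eq : ∀ n : ℕ+, g n n = 1
  eq_zero : ∀ (n : ℕ+) (k : ℤ), n < k → g n k = 0
  remainder_mem_orderLE : ∀ n, Z n ∈ orderLE (Fun A) 0
  eq_add : ∀ n : ℕ+, B n = zpowSum u (Ioc 0 n) (g n) + Z n

variable {I : AddSubmonoid ℕ} (hu : u.val.IsMonic 1) (hD : ∀ n, zsDeriv B n u.val = 0)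

include hu hD in
theorem ZSSystem.exists_sub_zpowSum_mem_orderLE_zero [IsAddTorsionFree A] (hB : ZSSystem I B)
    (n : ℕ+) : ∃ g, B n - zpowSum u (Ioc 0 n) g ∈ orderLE (Fun A) 0 := by
  let commHom : MicroDiff (Fun A) →+ MicroDiff (Fun A) :=
    AddMonoidHom.mulLeft u.val - AddMonoidHom.mulRight u.val
  obtain ⟨a, ha, hord⟩ := exists_expansion (isMonic_zpow hu)
    (𝒮 := (orderLE (Fun A) 0).comap commHom)
    (V := (ofTimes (A := A)).range.toAddSubgroup) (d := 0) (N := n) (P := B n)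
    (fun P hP j hj hPj => by
      have h := hu.coeff_comm hPj
      rw [mem_orderLE.1 (show u.val.comm P ∈ orderLE (Fun A) 0 from hP) _ (by omega),
        one_smul] at h
      exact ⟨_, (eq_ofTimes_xCoeff_zero h.symm).symm⟩)
    (by omega)
    (by
      rintro _ ⟨g, rfl⟩ k -
      have h := commute_zpowSum_zpow (u := u) {k} (fun _ => g) 1
      rw [zpowSum, sum_singleton, zpow_one] at h
      change u.val * _ - _ * u.val ∈ orderLE (Fun A) 0
      rw [h.eq, sub_self]
      exact zero_mem _)
    (by
      have h : (B n).comm u.val ∈ orderLE (Fun A) 0 := by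
        rw [comm_eq_opDeriv (hD n)]
        exact hu.opDeriv_mem_orderLE n
      change u.val * B n - B n * u.val ∈ orderLE (Fun A) 0
      rw [← neg_sub]
      exact neg_mem h)
    (hB.isMonic n).mem_orderLE
  choose g hg using ha
  exact ⟨g, by simpa only [zpowSum, hg] using hord⟩

include hu hD in
theorem ZSSystem.exists_isExpansion [IsAddTorsionFree A] (hB : ZSSystem I B) :
    ∃ g Z, IsExpansion B u g Z := by
  choose g hg using hB.exists_sub_zpowSum_mem_orderLE_zero hu hD
  refine ⟨fun n k => if k ≤ n then g n k else 0, fun n => B n - zpowSum u (Ioc 0 n) (g n),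
    fun n => ?_, fun n k hk => if_neg (by omega), hg, fun n => ?_⟩
  · have hn := n.pos
    have h := mem_orderLE.1 (hg n) n (by omega)
    rw [coeff_sub, (hB.isMonic n).1, coeff_zpowSum_top hu (fun k hk => (mem_Ioc.1 hk).2)
      (mem_Ioc.2 ⟨by omega, le_rfl⟩), sub_eq_zero] at h
    rw [if_pos le_rfl]
    exact ofTimes_injective (by rw [← h, map_one])
  · have : zpowSum u (Ioc 0 n) (fun k => if k ≤ n then g n k else 0) =
        zpowSum u (Ioc 0 n) (g n) :=
      sum_congr rfl fun k hk => by simp only [if_pos (mem_Ioc.1 hk).2]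
    rw [this, add_sub_cancel]

namespace IsExpansion

variable {g : ℕ+ → ℤ → MvPowerSeries ℕ+ A} {Z : ℕ+ → MicroDiff (Fun A)}

theorem eq_add_of_le (hg : IsExpansion B u g Z) {n : ℕ+} {N : ℤ} (hN : n ≤ N) :
    B n = zpowSum u (Ioc 0 N) (g n) + Z n := by
  rw [hg.eq_add n, zpowSum, sum_subset (Ioc_subset_Ioc_right hN)]
  · rfl
  · intro k hk hk'
    simp only [mem_Ioc] at hk hk'
    rw [hg.eq_zero n k (by omega), map_zero, ofFun_zero, zero_mul]

include hu hD in
theorem deriv_coeff_zero (hg : IsExpansion B u g Z) (n : ℕ+) :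
    ((Z n).coeff 0)′ = -tDeriv n (u.val.coeff 0) := by
  have hcomm : (Z n).comm u.val = opDeriv n u.val := by
    have h := commute_zpowSum_zpow (u := u) (Ioc 0 n) (g n) 1
    rw [zpow_one] at h
    rw [← comm_eq_opDeriv (hD n), hg.eq_add n, MicroDiff.comm, MicroDiff.comm, add_mul, mul_add,
      h.eq, add_sub_add_left_eq_sub]
  have h := hu.coeff_comm (hg.remainder_mem_orderLE n)
  rw [one_smul] at h
  rw [← h, ← coeff_opDeriv, ← hcomm, ← coeff_neg, MicroDiff.comm, MicroDiff.comm, neg_sub,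
    add_zero, sub_self]

include hu hD in
theorem zpowSum_pderiv_sub_eq (hg : IsExpansion B u g Z) (hB : ZSSystem I B) {m n : ℕ+} {N : ℤ}
    (hm : m ≤ N) (hn : n ≤ N) :
    (zpowSum u (Ioc 0 N) fun k =>
      MvPowerSeries.pderiv A m (g n k) - MvPowerSeries.pderiv A n (g m k)) =
      opDeriv n (Z m) - opDeriv m (Z n) - (Z n).comm (Z m) := by
  have hcomm := commute_zpowSum_zpowSum (u := u) (Ioc 0 N) (Ioc 0 N) (g n) (g m)
  have hBn := hg.eq_add_of_le hn
  have hBm := hg.eq_add_of_le hm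
  have hZS : zsDeriv B m (B n) = zsDeriv B n (B m) + (B n).comm (B m) := by
    rw [hB.zsDeriv_B, zsDeriv_apply, sub_add_cancel]
  rw [zpowSum_sub, ← zsDeriv_zpowSum hu (hD m), ← zsDeriv_zpowSum hu (hD n),
    eq_sub_of_add_eq hBn.symm, eq_sub_of_add_eq hBm.symm, map_sub, map_sub, hZS,
    zsDeriv_apply m (Z n), zsDeriv_apply n (Z m), hBn, hBm]
  simp only [MicroDiff.comm, add_mul, mul_add, hcomm.eq]
  abel

include hu hD in
theorem pderiv_comm (hg : IsExpansion B u g Z) (hB : ZSSystem I B) (m n : ℕ+) {k : ℤ}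
    (hk : 0 < k) : MvPowerSeries.pderiv A m (g n k) = MvPowerSeries.pderiv A n (g m k) := by
  refine sub_eq_zero.1 (eq_zero_of_zpowSum_mem_orderLE
    (g := fun k => MvPowerSeries.pderiv A m (g n k) - MvPowerSeries.pderiv A n (g m k)) hu ?_
    (mem_Ioc.2 ⟨hk, (by omega : k ≤ m + n + k)⟩) hk)
  rw [hg.zpowSum_pderiv_sub_eq hu hD hB (by omega) (by omega)]
  exact sub_mem (sub_mem (opDeriv_mem_orderLE n (hg.remainder_mem_orderLE m))
    (opDeriv_mem_orderLE m (hg.remainder_mem_orderLE n)))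
    (orderLE_mono (by omega)
      (comm_mem_orderLE (hg.remainder_mem_orderLE n) (hg.remainder_mem_orderLE m)))

include hu hD in
theorem tDeriv_coeff_zero_comm (hg : IsExpansion B u g Z) (hB : ZSSystem I B) (m n : ℕ+) :
    tDeriv m ((Z n).coeff 0) = tDeriv n ((Z m).coeff 0) := by
  have h := hg.zpowSum_pderiv_sub_eq hu hD hB (m := m) (n := n) (N := m + n) (by omega) (by omega)
  have hzero : (zpowSum u (Ioc 0 (m + n)) fun k =>
      MvPowerSeries.pderiv A m (g n k) - MvPowerSeries.pderiv A n (g m k)) = 0 :=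
    sum_eq_zero fun k hk => by
      simp only [hg.pderiv_comm hu hD hB m n (mem_Ioc.1 hk).1, sub_self, map_zero, ofFun_zero,
        zero_mul]
  have h0 := congrArg (fun P => P.coeff 0) (h.symm.trans hzero)
  have hcomm := mem_orderLE.1
    (comm_mem_orderLE (hg.remainder_mem_orderLE n) (hg.remainder_mem_orderLE m)) 0 (by omega)
  simp only [coeff_sub, coeff_zero, coeff_opDeriv, hcomm, sub_zero] at h0
  exact (sub_eq_zero.1 h0).symm

include hu in
theorem coeff_eq_add (hg : IsExpansion B u g Z) (n : ℕ+) :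
    (B (n + 1)).coeff n = (n + 1 : ℕ) * u.val.coeff 0 + ofTimes (g (n + 1) n) := by
  have hn := n.pos
  have hn1 : (((n + 1 : ℕ+) : ℕ) : ℤ) = (n : ℕ) + 1 := by push_cast; rfl
  have hpow := hu.coeff_pow_sub_one (n + 1)
  rw [show (((n : ℕ) + 1 : ℕ) : ℤ) - 1 = (n : ℕ) by push_cast; ring] at hpow
  have hself := hg.self_eq (n + 1)
  rw [hn1] at hself
  rw [hg.eq_add (n + 1), coeff_add, mem_orderLE.1 (hg.remainder_mem_orderLE _) _ (by omega),
    add_zero, coeff_zpowSum, hn1, sum_eq_add_of_mem ((n : ℕ) + 1 : ℤ) (n : ℕ) (mem_Ioc.2 (by omega))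
      (mem_Ioc.2 (by omega)) (by omega), hself, map_one, one_mul, (isMonic_zpow hu n).1, mul_one,
    ← hpow]
  · norm_cast
  · intro k hk hne
    rw [mem_Ioc] at hk
    rw [mem_orderLE.1 (isMonic_zpow hu k).mem_orderLE _ (by omega), mul_zero]

theorem eq_plus_add (hg : IsExpansion B u g Z) (hB : ZSSystem I B) (n : ℕ+) :
    B n = ∑ k ∈ Iic n, ofFun (ofTimes (g n k)) * (u.val ^ (k : ℕ)).plus +
      ofFun ((Z n).coeff 0) := by
  have hZ : (Z n).plus = ofFun ((Z n).coeff 0) := by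
    ext1 k
    rw [coeff_plus, coeff_ofFun]
    rcases lt_trichotomy k 0 with h | rfl | h
    · rw [if_neg (by omega), if_neg (by omega)]
    · rw [if_pos le_rfl, if_pos rfl]
    · rw [if_pos h.le, if_neg h.ne', mem_orderLE.1 (hg.remainder_mem_orderLE n) k h]
  rw [← (hB.isDifferential n).plus_eq, hg.eq_add n, plus_add, hZ, zpowSum, plus_sum]
  congr 1
  symm
  refine sum_bij (fun k _ => ((k : ℕ) : ℤ)) (fun k hk => ?_) (fun k _ j _ h => ?_)
    (fun k hk => ?_) fun k _ => ?_
  · rw [mem_Iic, ← PNat.coe_le_coe] at hk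
    exact mem_Ioc.2 ⟨by exact_mod_cast k.pos, by exact_mod_cast hk⟩
  · exact PNat.coe_injective (by exact_mod_cast h)
  · rw [mem_Ioc] at hk
    refine ⟨k.toNat.toPNat', ?_, ?_⟩
    · rw [mem_Iic, ← PNat.coe_le_coe, PNat.toPNat'_coe (by omega)]
      omega
    · rw [PNat.toPNat'_coe (by omega)]
      omega
  · rw [plus_ofFun_mul, zpow_natCast, Units.val_pow_eq_pow_val]

end IsExpansion

end Expansion

/-! ### The time variables and the gauge function -/

section Integration

open MvPowerSeries (constantCoeff pderiv)

variable {A : Type*} [CommRing A]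

theorem isTriangular_of_pderiv [IsAddTorsionFree A] {τ : ℕ+ → MvPowerSeries ℕ+ A}
    (h0 : ∀ n, constantCoeff (τ n) = 0) (hself : ∀ n, pderiv A n (τ n) = 1)
    (hlt : ∀ m n, m < n → pderiv A m (τ n) = 0) : IsTriangular τ := by
  classical
  intro n α hα
  refine ⟨?_, fun m hm => ?_⟩
  · rintro rfl
    apply hα
    rw [map_sub, MvPowerSeries.coeff_zero_eq_constantCoeff_apply,
      MvPowerSeries.coeff_zero_eq_constantCoeff_apply, h0, MvPowerSeries.constantCoeff_X, sub_zero]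
  · by_contra! hmn
    have hαm := Finsupp.mem_support_iff.1 hm
    have hpderiv : pderiv A m (τ n - MvPowerSeries.X n) = 0 := by
      rcases hmn.eq_or_lt with rfl | h
      · rw [map_sub, hself, MvPowerSeries.pderiv_X_self, sub_self]
      · rw [map_sub, hlt m n h, MvPowerSeries.pderiv_X_of_ne h.ne', sub_zero]
    have hcoeff := coeff_pderiv_sub_single hαm (τ n - MvPowerSeries.X n)
    rw [hpderiv, map_zero] at hcoeff
    exact hα ((nsmul_eq_zero_iff_right hαm).1 hcoeff.symm)

theorem exists_isTriangular_pderiv_eq [Module ℚ A] {g : ℕ+ → ℕ+ → MvPowerSeries ℕ+ A}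
    (hself : ∀ n, g n n = 1) (hlt : ∀ n k, n < k → g n k = 0)
    (hclosed : ∀ m n k, pderiv A m (g n k) = pderiv A n (g m k)) :
    ∃ τ : ℕ+ → MvPowerSeries ℕ+ A, IsTriangular τ ∧ ∀ n k, pderiv A n (τ k) = g n k := by
  have := IsAddTorsionFree.of_module_rat A
  choose τ h0 hτ _ using fun k => exists_pderiv_eq fun m n => hclosed m n k
  exact ⟨τ, isTriangular_of_pderiv h0 (fun n => by rw [hτ, hself])
    fun m n h => by rw [hτ, hlt m n h], fun n k => hτ k n⟩

variable {I : AddSubmonoid ℕ}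

theorem mem_coeffsIn_poleLE_of_deriv_eq_tDeriv [IsAddTorsionFree A] {N : ℕ} {f v : Fun A} {n : ℕ+}
    (hv : v ∈ coeffsIn ℕ+ (poleLE A N)) (hf : f′ = tDeriv n v) :
    f ∈ coeffsIn ℕ+ (poleLE A N) := fun α i hi => by
  have h := coeff_coeff_xDeriv f α (i - 1)
  have h0 : (MvPowerSeries.coeff α (tDeriv n v)).coeff (i - 1) = 0 := by
    rw [tDeriv, MvPowerSeries.coeff_pderiv, mul_comm, ← Nat.cast_succ, ← nsmul_eq_mul,
      HahnSeries.coeff_smul, hv _ _ (by omega), smul_zero]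
  rw [show xDeriv A f = tDeriv n v from hf, h0, sub_add_cancel] at h
  exact (smul_eq_zero.1 h.symm).resolve_left (by omega)

theorem exists_tDeriv_eq [Module ℚ A] {g : ℕ+ → Fun A} {v : Fun A}
    (hclosed : ∀ m n, tDeriv m (g n) = tDeriv n (g m)) (hv : v ∈ bddSubring A I)
    (hg : ∀ n, (g n)′ = -tDeriv n v) :
    ∃ f ∈ bddSubring A I, constantCoeff f = 0 ∧ ∀ n, tDeriv n f = g n := by
  have := IsAddTorsionFree.of_module_rat A
  obtain ⟨N, hN, hv⟩ := hv
  obtain ⟨f, h0, hf, hmem⟩ := exists_pderiv_eq hclosed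
  exact ⟨f, ⟨N, hN, hmem ((poleLE A N).restrictScalars ℚ) fun n =>
    mem_coeffsIn_poleLE_of_deriv_eq_tDeriv (neg_mem hv) (by rw [hg, map_neg])⟩, h0, hf⟩

theorem eq_zero_of_forall_tDeriv_eq_zero [IsAddTorsionFree A] {f : Fun A}
    (hf : f′ = 0) (ht : ∀ n, tDeriv n f = 0) (h0 : (constantCoeff f).coeff 0 = 0) : f = 0 := by
  have hf₀ : f = ofTimes (xCoeff 0 f) := eq_ofTimes_xCoeff_zero hf
  have hpderiv (n : ℕ+) : pderiv A n (xCoeff 0 f) = 0 :=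
    ofTimes_injective (by rw [← tDeriv_ofTimes, ← hf₀, ht, map_zero])
  have hzero : xCoeff 0 f = 0 :=
    MvPowerSeries.pderiv.ext (fun n => by rw [hpderiv, map_zero]) (by rw [map_zero]; exact h0)
  rw [hf₀, hzero, map_zero]

theorem deriv_eq_zero_of_forall_tDeriv_deriv_eq_zero [IsAddTorsionFree (LaurentSeries A)]
    {f : Fun A} (h0 : constantCoeff f = 0) (ht : ∀ n, tDeriv n f′ = 0) : f′ = 0 := by
  refine MvPowerSeries.pderiv.ext (fun n => (ht n).trans (map_zero _).symm) ?_
  change LaurentSeries.derivative ℤ (constantCoeff f) = constantCoeff 0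
  rw [h0, map_zero, map_zero]

end Integration

section Lax

open MicroDiff

open MvPowerSeries (constantCoeff pderiv)

variable {A : Type*} [CommRing A] {B : ℕ+ → MicroDiff (Fun A)} {I : AddSubmonoid ℕ}

theorem ZSSystem.exists_normalized_solution [Algebra ℚ A] (hB : ZSSystem I B) :
    ∃ X : MicroDiff (Fun A), X.IsMonic 1 ∧
      X ∈ opSubring (bddSubring A I) deriv_mem_bddSubring ∧ (∀ n, zsDeriv B n X = 0) ∧
      (constantCoeff (X.coeff 0)).coeff 0 = 0 := by
  obtain ⟨M, hM, hmem, hD⟩ := hB.exists_solution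
  let c : MvPowerSeries ℕ+ A := MvPowerSeries.C ((constantCoeff (M.coeff 0)).coeff 0)
  refine ⟨M - ofFun (ofTimes c), isMonic_iff.2 ⟨?_, sub_mem hM.mem_orderLE ?_⟩,
    sub_mem hmem (ofFun_mem_opSubring (ofTimes_mem_bddSubring c)), fun n => ?_, ?_⟩
  · rw [coeff_sub, coeff_ofFun, if_neg one_ne_zero, hM.1, sub_zero]
  · exact orderLE_mono zero_le_one (ofFun_mem_orderLE _)
  · rw [map_sub, hD, zsDeriv_ofFun_ofTimes, MvPowerSeries.pderiv_C, map_zero, ofFun_zero,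
      sub_zero]
  · have hc := coeff_coeff_ofTimes c 0 0
    rw [if_pos rfl, MvPowerSeries.coeff_zero_C,
      MvPowerSeries.coeff_zero_eq_constantCoeff_apply] at hc
    rw [coeff_sub, coeff_ofFun, if_pos rfl, map_sub, HahnSeries.coeff_sub, hc, sub_self]

theorem laxEquations_of_opDeriv {τ : ℕ+ → MvPowerSeries ℕ+ A} (hτ : IsTriangular τ)
    {L : MicroDiff (Fun A)} (hL : ∀ k, L.coeff k ∈ bddSubring A I)
    (hself : ∀ n, tDeriv n (ofTimes (τ n)) = 1)
    (h : ∀ n, opDeriv n L =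
      ∑ k ∈ Iic n, ofFun (tDeriv n (ofTimes (τ k))) * (L ^ (k : ℕ)).plus.comm L) :
    LaxEquations (bddSubring A I) τ L := by
  intro n k
  obtain ⟨φ, hφ, hLφ⟩ := (bijOn_timeChange hτ I).surjOn (hL k)
  refine ⟨φ, hφ, hLφ, ?_⟩
  induction n using WellFoundedLT.induction with
  | ind n ih =>
    have hchain := tDeriv_timeChange hτ n φ
    rw [hLφ, ← coeff_opDeriv, h n, coeff_sum, ← Iio_insert, sum_insert (by simp),
      sum_insert (by simp), hself, coeff_ofFun_mul, one_mul, mul_one,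
      sum_congr rfl fun j hj => ?_, add_left_inj] at hchain
    · exact hchain.symm
    · rw [coeff_ofFun_mul, ih j (mem_Iio.1 hj), mul_comm]

namespace IsExpansion

variable {u : (MicroDiff (Fun A))ˣ} {g : ℕ+ → ℤ → MvPowerSeries ℕ+ A}
  {Z : ℕ+ → MicroDiff (Fun A)}

theorem exists_isTriangular [Algebra ℚ A] (hg : IsExpansion B u g Z) (hB : ZSSystem I B)
    (hu : u.val.IsMonic 1) (hD : ∀ n, zsDeriv B n u.val = 0) :
    ∃ τ : ℕ+ → MvPowerSeries ℕ+ A, IsTriangular τ ∧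
      ∀ n k : ℕ+, tDeriv n (ofTimes (τ k)) = ofTimes (g n k) := by
  have := IsAddTorsionFree.of_module_rat A
  obtain ⟨τ, hτ, hτg⟩ := exists_isTriangular_pderiv_eq (g := fun n k => g n k) hg.self_eq
    (fun n k hk => hg.eq_zero n k (by exact_mod_cast hk))
    fun m n k => hg.pderiv_comm hu hD hB m n (by exact_mod_cast k.pos)
  exact ⟨τ, hτ, fun n k => by rw [tDeriv_ofTimes, hτg]⟩

theorem coeff_zero_eq_zero [Algebra ℚ A] (hg : IsExpansion B u g Z) (hB : ZSSystem I B)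
    (hu : u.val.IsMonic 1) (hD : ∀ n, zsDeriv B n u.val = 0)
    (h0 : (constantCoeff (u.val.coeff 0)).coeff 0 = 0)
    (hBn : ∀ n : ℕ+, (B n).coeff (((n : ℕ) : ℤ) - 1) = 0) : u.val.coeff 0 = 0 := by
  have := IsAddTorsionFree.of_module_rat A
  have := IsAddTorsionFree.of_module_rat (Fun A)
  have hcoeff (n : ℕ+) : (n + 1 : ℕ) • u.val.coeff 0 = -ofTimes (g (n + 1) n) := by
    have h := hBn (n + 1)
    rw [show (((n + 1 : ℕ+) : ℕ) : ℤ) - 1 = (n : ℕ) by push_cast; ring, hg.coeff_eq_add hu] at h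
    rw [nsmul_eq_mul]
    exact eq_neg_of_add_eq_zero_left h
  refine eq_zero_of_forall_tDeriv_eq_zero ?_ (fun n => ?_) h0
  · refine (nsmul_eq_zero_iff_right (n := (1 : ℕ+) + 1) (by simp)).1 ?_
    have hderiv : (ofTimes (g (1 + 1) 1))′ = 0 := xDeriv_ofTimes _
    rw [← map_nsmul, hcoeff 1, map_neg]
    exact neg_eq_zero.2 hderiv
  · have hself : pderiv A n (g (n + 1) n) = 0 := by
      rw [hg.pderiv_comm hu hD hB _ _ (by exact_mod_cast n.pos), hg.self_eq,
        Derivation.map_one_eq_zero]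
    refine (nsmul_eq_zero_iff_right n.val.succ_ne_zero).1 ?_
    rw [← map_nsmul, Nat.succ_eq_add_one, hcoeff, map_neg, tDeriv_ofTimes, hself, map_zero,
      neg_zero]

theorem opDeriv_gauge [Algebra ℂ A] (hg : IsExpansion B u g Z) (hB : ZSSystem I B)
    (hD : ∀ n, zsDeriv B n u.val = 0) {f : Fun A} (hf : constantCoeff f = 0)
    (hfZ : ∀ n, tDeriv n f = (Z n).coeff 0) (n : ℕ+) :
    opDeriv n (gauge f hf u) =
      ∑ k ∈ Iic n, ofFun (ofTimes (g n k)) *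
        (gauge f hf u ^ (k : ℕ)).plus.comm (gauge f hf u) := by
  have hcomm : opDeriv n u.val - (ofFun (tDeriv n f)).comm u.val =
      ∑ k ∈ Iic n, ofFun (ofTimes (g n k)) * (u.val ^ (k : ℕ)).plus.comm u.val := by
    rw [← comm_eq_opDeriv (hD n), hfZ, hg.eq_plus_add hB n]
    simp only [MicroDiff.comm, add_mul, mul_add, add_sub_add_comm, add_sub_cancel_right, sum_mul,
      mul_sum, ← sum_sub_distrib, mul_sub, mul_assoc,
      (commute_ofFun_ofTimes _ u.val).symm.left_comm]
  rw [KP.opDeriv_gauge, hcomm]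
  simp only [map_sum, map_mul, gauge_ofFun, MicroDiff.comm, map_sub, ← plus_gauge, map_pow]

theorem laxEquations [Algebra ℂ A] (hg : IsExpansion B u g Z) (hB : ZSSystem I B)
    (hmem : u.val ∈ opSubring (bddSubring A I) deriv_mem_bddSubring)
    (hD : ∀ n, zsDeriv B n u.val = 0) {τ : ℕ+ → MvPowerSeries ℕ+ A} (hτ : IsTriangular τ)
    (hτg : ∀ n k : ℕ+, tDeriv n (ofTimes (τ k)) = ofTimes (g n k)) {f : Fun A}
    (hfI : f ∈ bddSubring A I) (hf : constantCoeff f = 0)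
    (hfZ : ∀ n, tDeriv n f = (Z n).coeff 0) :
    LaxEquations (bddSubring A I) τ (gauge f hf u) :=
  laxEquations_of_opDeriv hτ (gauge_mem_opSubring hf hfI hmem)
    (fun n => by rw [hτg, hg.self_eq, map_one])
    fun n => by simp only [hτg, hg.opDeriv_gauge hB hD hf hfZ]

theorem eq_tildeB_add [Algebra ℂ A] (hg : IsExpansion B u g Z) (hB : ZSSystem I B) {f : Fun A}
    (hf : constantCoeff f = 0) (hfZ : ∀ n, tDeriv n f = (Z n).coeff 0) (n : ℕ+) :
    B n = tildeB f (gauge f hf u) n +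
      ∑ k ∈ Iio n, ofFun (ofTimes (g n k)) * tildeB f (gauge f hf u) k + ofFun (tDeriv n f) := by
  simp only [tildeB_gauge, hfZ]
  rw [hg.eq_plus_add hB n, ← Iio_insert, sum_insert (by simp), hg.self_eq, map_one, ofFun_one,
    one_mul]

theorem deriv_eq_zero [Algebra ℚ A] (hg : IsExpansion B u g Z) (hu : u.val.IsMonic 1)
    (hD : ∀ n, zsDeriv B n u.val = 0) (hu0 : u.val.coeff 0 = 0) {f : Fun A}
    (hf : constantCoeff f = 0) (hfZ : ∀ n, tDeriv n f = (Z n).coeff 0) : f′ = 0 := by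
  have := IsAddTorsionFree.of_module_rat (LaurentSeries A)
  refine deriv_eq_zero_of_forall_tDeriv_deriv_eq_zero hf fun n => (tDeriv_xDeriv n f).trans ?_
  have h := hg.deriv_coeff_zero hu hD n
  rwa [← hfZ, hu0, map_zero, neg_zero] at h

end IsExpansion

end Lax

end KP

end

theorem mainTheorem1 {A : Type*} [CommRing A] [Algebra ℂ A]
    (S : Set (KP.Fun A)) (hS : S = KP.powerFun A ∨ S = KP.laurentFun A)
    (B : ℕ+ → KP.MicroDiff (KP.Fun A))
    (hBS : ∀ n k, (B n).coeff k ∈ S)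
    (hBdiff : ∀ n, (B n).IsDifferential)
    (hBmonic : ∀ n : ℕ+, (B n).IsMonic ((n : ℕ) : ℤ))
    (hZS : KP.ZakharovShabat B) :
    ∃ (L : KP.MicroDiff (KP.Fun A)) (τ : ℕ+ → MvPowerSeries ℕ+ A) (f₀ : KP.Fun A),
      (∀ k, L.coeff k ∈ S) ∧ L.IsMonic 1 ∧
      KP.IsTriangular τ ∧ Set.BijOn (KP.timeChange τ) S S ∧
      f₀ ∈ S ∧ MvPowerSeries.constantCoeff f₀ = 0 ∧
      KP.LaxEquations S τ L ∧
      (∀ n : ℕ+, B n = KP.tildeB f₀ L n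
        + ∑ k ∈ Finset.Iio n,
            KP.MicroDiff.ofFun (KP.tDeriv n (KP.ofTimes (τ k))) * KP.tildeB f₀ L k
        + KP.MicroDiff.ofFun (KP.tDeriv n f₀)) ∧
      ((∀ n : ℕ+, (B n).coeff (((n : ℕ) : ℤ) - 1) = 0) →
        L.coeff 0 = 0 ∧ KP.xDeriv A f₀ = 0 ∧
          ∀ n : ℕ+, KP.tildeB f₀ L n = (L ^ (n : ℕ)).plus) := by
  obtain ⟨I, rfl⟩ : ∃ I : AddSubmonoid ℕ, S = KP.bddSubring A I := by
    rcases hS with rfl | rfl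
    · exact ⟨⊥, KP.powerFun_eq A⟩
    · exact ⟨⊤, KP.laurentFun_eq A⟩
  have hB : KP.ZSSystem I B := ⟨hBS, hBdiff, hBmonic, hZS⟩
  let _ : Algebra ℚ A := .compHom A (algebraMap ℚ ℂ)
  have := IsAddTorsionFree.of_module_rat A
  obtain ⟨X, hu, hmem, hD, hu0⟩ := hB.exists_normalized_solution
  obtain ⟨u, rfl⟩ := hu.isUnit
  obtain ⟨g, Z, hg⟩ := hB.exists_isExpansion hu hD
  obtain ⟨τ, hτ, hτg⟩ := hg.exists_isTriangular hB hu hD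
  obtain ⟨f, hfI, hf, hfZ⟩ := KP.exists_tDeriv_eq (hg.tDeriv_coeff_zero_comm hu hD hB) (hmem 0)
    (hg.deriv_coeff_zero hu hD)
  refine ⟨KP.gauge f hf u, τ, f, KP.gauge_mem_opSubring hf hfI hmem, hu.gauge hf, hτ,
    KP.bijOn_timeChange hτ I, hfI, hf, ?lax, fun n => ?expansion, fun hBn => ?normalized⟩
  case lax => exact hg.laxEquations hB hmem hD hτ hτg hfI hf hfZ
  case expansion => simpa only [hτg] using hg.eq_tildeB_add hB hf hfZ n
  case normalized =>
    have hv := hg.coeff_zero_eq_zero hB hu hD hu0 hBn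
    have hf' := hg.deriv_eq_zero hu hD hv hf hfZ
    have hL := KP.gauge_eq_self_of_deriv_eq_zero hf hf'
    exact ⟨by rw [hL, hv], hf', fun n => by rw [KP.tildeB_gauge, hL]⟩
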